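/- Let $V:(0,\infty)\to\mathbb C$ be a measurable potential such that $\int_0^\infty e^{ax}|V(x)|\,dx<\infty$ for a certain $a>0$. Let $L_V=-d^2/dx^2+V(x)$ be the Schrödinger operator in $L^2(0,\infty)$ with Dirichlet boundary condition at zero; its domain consists of all $y\in L^2(0,\infty)$ with $y,y'$ locally absolutely continuous on $[0,\infty)$, $y(0)=0$ and $-y''+Vy\in L^2(0,\infty)$. For $k$ with $\operatorname{Im}k\ge 0$ let $e(x,k)$ be the Jost solution, i.e. the solution of $-y''+V(x)y=k^2y$ on $[0,\infty)$ with $e(x,k)\sim e^{ikx}$ as $x\to\infty$, and let $e(k)=e(0,k)$ be the Jost function. The spectral singularities of $L_V$ are the points $\lambda=k^2$ with $k\in\mathbb R$, $e(k)=0$; the multiplicity of such a point is the order of the zero $k$ of (the analytic continuation of) $e(\cdot)$. Let $N(V)$ be the total multiplicity of the eigenvalues of $L_V$ (each counted with its algebraic multiplicity, the dimension of its root subspace) and of the spectral singularities. Let $R\ge 0$ be the minimal radius of discs centred at the origin that contain all zeros of $e(k)$ in the closed upper half-plane, and for $\alpha\in[0,1)$ put $$\widetilde R(\alpha)=\Big(\frac1{\ln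 2}\int_0^\infty(2x)^\alpha|V(x)|\,dx\Big)^{1/(1-\alpha)} .$$ Then for all $\alpha,\beta\in[0,1)$ and all $A>\max\{\widetilde R(\alpha),\,R^2/a-a/4\}$, $$N(V)\ \le\ \Big(\ln\frac{A+a/2}{\sqrt{A^2+R^2}}\Big)^{-1}\bigg\{\frac1{a^{1-\beta}}\int_0^\infty x^\beta(1+e^{ax})|V(x)|\,dx-\ln\Big(2-2^{(\widetilde R(\alpha)/A)^{1-\alpha}}\Big)\bigg\},$$ where the right-hand side is understood as $+\infty$ if the integral diverges (which is possible only for $\beta>0$). -/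

import Mathlib

open MeasureTheory Set Filter Topology
open scoped ENNReal

noncomputable section

namespace HalfLineSchrodinger

/-- `y` solves `-y'' + V y = f` on `[0, ∞)`: `y` is differentiable on `[0, ∞)` with a locally
absolutely continuous derivative `p`, and `p' = V y - f` almost everywhere. Absolute continuity
of `p` is expressed by `p` being the integral of the locally integrable function `V y - f`. -/
def Solves (V f y : ℝ → ℂ) : Prop :=
  ∃ p : ℝ → ℂ,
    (∀ x, 0 ≤ x → HasDerivWithinAt y (p x) (Ici 0) x) ∧
    (∀ x, 0 ≤ x → IntervalIntegrable (fun t => V t * y t - f t) volume 0 x) ∧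
    ∀ x, 0 ≤ x → p x = p 0 + ∫ t in (0 : ℝ)..x, (V t * y t - f t)

/-- The Hilbert space `L²(0, ∞)`. -/
abbrev H : Type := Lp ℂ 2 (volume.restrict (Ioi (0 : ℝ)))

theorem Solves.congr {V f g y : ℝ → ℂ} (h : Solves V f y)
    (hfg : f =ᵐ[volume.restrict (Ioi (0 : ℝ))] g) : Solves V g y := by
  obtain ⟨p, h1, h2, h3⟩ := h
  have key : ∀ x, 0 ≤ x → (fun t => V t * y t - f t) =ᵐ[volume.restrict (uIoc 0 x)]
      (fun t => V t * y t - g t) := by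
    intro x hx
    have : f =ᵐ[volume.restrict (uIoc 0 x)] g :=
      ae_restrict_of_ae_restrict_of_subset
        (by rw [uIoc_of_le hx]; exact fun t ht => ht.1) hfg
    filter_upwards [this] with t ht
    rw [ht]
  refine ⟨p, h1, fun x hx => (h2 x hx).congr_ae (key x hx), fun x hx => ?_⟩
  rw [h3 x hx, intervalIntegral.integral_congr_ae_restrict (key x hx)]

theorem Solves.add {V f g y z : ℝ → ℂ} (h : Solves V f y) (h' : Solves V g z) :
    Solves V (f + g) (y + z) := by
  obtain ⟨p, h1, h2, h3⟩ := h
  obtain ⟨q, k1, k2, k3⟩ := h'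
  have e : (fun t => V t * (y + z) t - (f + g) t) =
      fun t => (V t * y t - f t) + (V t * z t - g t) := by
    funext t; simp only [Pi.add_apply]; ring
  refine ⟨p + q, fun x hx => (h1 x hx).add (k1 x hx), fun x hx => ?_, fun x hx => ?_⟩
  · rw [e]; exact (h2 x hx).add (k2 x hx)
  · rw [e, intervalIntegral.integral_add (h2 x hx) (k2 x hx)]
    simp only [Pi.add_apply]
    rw [h3 x hx, k3 x hx]; ring

theorem Solves.smul {V f y : ℝ → ℂ} (c : ℂ) (h : Solves V f y) :
    Solves V (c • f) (c • y) := by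
  obtain ⟨p, h1, h2, h3⟩ := h
  have e : (fun t => V t * (c • y) t - (c • f) t) = fun t => c * (V t * y t - f t) := by
    funext t; simp only [Pi.smul_apply, smul_eq_mul]; ring
  refine ⟨c • p, fun x hx => (h1 x hx).const_smul c, fun x hx => ?_, fun x hx => ?_⟩
  · rw [e]; exact (h2 x hx).const_mul c
  · rw [e, intervalIntegral.integral_const_mul]
    simp only [Pi.smul_apply, smul_eq_mul]
    rw [h3 x hx]; ring

/-- The graph of `L_V = -d²/dx² + V` with the Dirichlet condition at zero, on its maximal domain:
all pairs `(u, f)` in `L²(0, ∞)` such that `u` has a representative `y` with a locally absolutely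
continuous derivative, `y(0) = 0` and `-y'' + V y = f`. -/
def graph (V : ℝ → ℂ) : Submodule ℂ (H × H) where
  carrier := {w | ∃ y : ℝ → ℂ,
    w.1 =ᵐ[volume.restrict (Ioi (0 : ℝ))] y ∧ y 0 = 0 ∧ Solves V w.2 y}
  add_mem' := by
    rintro ⟨u, f⟩ ⟨v, g⟩ ⟨y, hy, hy0, hs⟩ ⟨z, hz, hz0, ht⟩
    refine ⟨y + z, (Lp.coeFn_add u v).trans (hy.add hz), by simp [hy0, hz0], ?_⟩
    exact (hs.add ht).congr (Lp.coeFn_add f g).symm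
  zero_mem' := by
    refine ⟨0, Lp.coeFn_zero _ _ _, rfl, ?_⟩
    have : Solves V 0 0 := ⟨0, fun x _ => hasDerivWithinAt_const x _ (0 : ℂ), by simp, by simp⟩
    exact this.congr (Lp.coeFn_zero _ _ _).symm
  smul_mem' := by
    rintro c ⟨u, f⟩ ⟨y, hy, hy0, hs⟩
    refine ⟨c • y, (Lp.coeFn_smul c u).trans (hy.const_smul c), by simp [hy0], ?_⟩
    exact (hs.smul c).congr (Lp.coeFn_smul c f).symm

/-- `graph V` is the graph of a (single-valued) operator. -/
theorem graph_single_valued (V : ℝ → ℂ) (w : H × H) (hw : w ∈ graph V) (h0 : w.1 = 0) :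
    w.2 = 0 := by
  obtain ⟨y, hy, hy0, p, h1, h2, h3⟩ := hw
  rw [h0] at hy
  have hyae : y =ᵐ[volume.restrict (Ioi (0 : ℝ))] fun _ => (0 : ℂ) :=
    hy.symm.trans (Lp.coeFn_zero _ _ _)
  have hyc : ContinuousOn y (Ici 0) := fun x hx => (h1 x hx).continuousWithinAt
  have hyz' : EqOn y (fun _ => (0 : ℂ)) (Ioi 0) :=
    Measure.eqOn_open_of_ae_eq hyae isOpen_Ioi (hyc.mono Ioi_subset_Ici_self)
      continuousOn_const
  have hyz : ∀ x, 0 ≤ x → y x = 0 := by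
    intro x hx
    rcases hx.eq_or_lt with rfl | hx
    · exact hy0
    · exact hyz' hx
  have hp : ∀ x, 0 ≤ x → p x = 0 := by
    intro x hx
    have hd : HasDerivWithinAt y 0 (Ici 0) x :=
      (hasDerivWithinAt_const x (Ici 0) (0 : ℂ)).congr (fun t ht => hyz t ht) (hyz x hx)
    exact (uniqueDiffOn_Ici (0 : ℝ) x hx).eq_deriv _ (h1 x hx) hd
  have hint : ∀ x, 0 ≤ x → ∫ t in (0 : ℝ)..x, (V t * y t - w.2 t) = 0 := by
    intro x hx
    have := h3 x hx
    rw [hp x hx, hp 0 le_rfl, zero_add] at this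
    exact this.symm
  have hloc : ∀ n : ℕ, ∀ᵐ x, x ∈ Ioo (0 : ℝ) n → w.2 x = 0 := by
    intro n
    have hd := (h2 n n.cast_nonneg).ae_hasDerivAt_integral
    filter_upwards [hd] with x hx hxn
    have hxn' : x ∈ uIcc (0 : ℝ) n := by
      rw [uIcc_of_le n.cast_nonneg]; exact Ioo_subset_Icc_self hxn
    have hx1 := hx hxn' 0 left_mem_uIcc
    have hx2 : HasDerivAt (fun b => ∫ t in (0 : ℝ)..b, (V t * y t - w.2 t)) 0 x := by
      refine (hasDerivAt_const x (0 : ℂ)).congr_of_eventuallyEq ?_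
      filter_upwards [lt_mem_nhds hxn.1] with b hb
      exact hint b hb.le
    have := hx1.unique hx2
    rw [hyz x hxn.1.le] at this
    simpa using this
  apply Lp.ext
  refine EventuallyEq.trans ?_ (Lp.coeFn_zero _ _ _).symm
  rw [EventuallyEq, ae_restrict_iff' measurableSet_Ioi]
  filter_upwards [ae_all_iff.2 hloc] with x hx hx0
  obtain ⟨n, hn⟩ := exists_nat_gt x
  exact hx n ⟨hx0, hn⟩

/-- The Dirichlet Schrödinger operator `L_V = -d²/dx² + V` in `L²(0, ∞)`. -/
def operator (V : ℝ → ℂ) : H →ₗ.[ℂ] H := (graph V).toLinearPMap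

theorem operator_graph (V : ℝ → ℂ) : (operator V).graph = graph V :=
  Submodule.toLinearPMap_graph_eq _ (graph_single_valued V)

/-- The kernel of `(T - z)ⁿ` for an unbounded operator `T`. -/
def kerPow {E : Type*} [AddCommGroup E] [Module ℂ E] (T : E →ₗ.[ℂ] E) (z : ℂ) :
    ℕ → Submodule ℂ E
  | 0 => ⊥
  | n + 1 => ((kerPow T z n).comap (T.toFun - z • T.domain.subtype)).map T.domain.subtype

/-- Algebraic multiplicity of `z` as an eigenvalue of `T`: the dimension of the root subspace
`⋃ₙ ker (T - z)ⁿ` (it is `0` exactly when `z` is not an eigenvalue). -/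
def algMultiplicity {E : Type*} [AddCommGroup E] [Module ℂ E] (T : E →ₗ.[ℂ] E) (z : ℂ) : ℕ∞ :=
  Cardinal.toENat (Module.rank ℂ (⨆ n, kerPow T z n : Submodule ℂ E))

/-- `y` is a Jost solution: `-y'' + V y = k² y` on `[0, ∞)` and `y(x) ~ exp(ikx)` at infinity. -/
def IsJostSolution (V : ℝ → ℂ) (k : ℂ) (y : ℝ → ℂ) : Prop :=
  Solves V (fun x => k ^ 2 * y x) y ∧
    Tendsto (fun x : ℝ => y x * Complex.exp (-(Complex.I * k * x))) atTop (𝓝 1)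

/-- The Jost solution `e(x, k)`, for `k` in the closed upper half-plane. When
`∫ (1 + x) |V| < ∞` it exists there and is unique on `[0, ∞)`. -/
def jostSolution (V : ℝ → ℂ) (k : ℂ) : ℝ → ℂ := Classical.epsilon (IsJostSolution V k)

/-- The Jost function `e(k) = e(0, k)` on the closed upper half-plane. -/
def jost (V : ℝ → ℂ) (k : ℂ) : ℂ := jostSolution V k 0

/-- The closed upper half-plane. -/
def closedUpper : Set ℂ := {k | 0 ≤ k.im}

/-- Order of vanishing at a real point `k` of a function `F` on the closed upper half-plane: the
largest `n` with `F(w) = O(|w - k|ⁿ)` as `w → k`, `Im w ≥ 0`. If `F` continues analytically to a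
neighbourhood of `k`, this is the order of the zero of the continuation. -/
def boundaryOrder (F : ℂ → ℂ) (k : ℝ) : ℕ∞ :=
  ⨆ (n : ℕ) (_ : F =O[𝓝[closedUpper] (k : ℂ)] fun w => (w - k) ^ n), (n : ℕ∞)

/-- The total multiplicity `N(V)` of the eigenvalues of `L_V` (each with its algebraic
multiplicity) and of its spectral singularities, i.e. the real zeros of the Jost function
(each with its order). -/
def totalMultiplicity (V : ℝ → ℂ) : ℝ≥0∞ :=
  (∑' z : ℂ, (algMultiplicity (operator V) z : ℝ≥0∞)) +
    ∑' k : ℝ, (boundaryOrder (jost V) k : ℝ≥0∞)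

/-- `R`: the minimal radius of a disc about the origin that contains all zeros of the Jost
function in the closed upper half-plane. -/
def zeroRadius (V : ℝ → ℂ) : ℝ :=
  sInf {r : ℝ | 0 ≤ r ∧ ∀ k ∈ closedUpper, jost V k = 0 → ‖k‖ ≤ r}

/-- `R̃(α) = ((1 / ln 2) ∫₀^∞ (2x)^α |V(x)| dx)^(1 / (1 - α))`. -/
def radiusBound (V : ℝ → ℂ) (α : ℝ) : ℝ :=
  (1 / Real.log 2 * ∫ x in Ioi (0 : ℝ), (2 * x) ^ α * ‖V x‖) ^ (1 / (1 - α))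

end HalfLineSchrodinger

end

noncomputable section

namespace HalfLineSchrodinger

/-! ### Locally absolutely continuous functions on the half-line -/

section Primitive

variable {E : Type*} [NormedAddCommGroup E] [NormedSpace ℝ E]

/-! The zeros of the Jost function are counted by Jensen's inequality on discs centred at iA. Write
e(x,k) = e^{ikx} m(x,k). The factor m solves the Volterra equation m(x) = 1 + ∫ₓ^∞ D(t-x) V(t) m(t)
dt with D(s) = ∫₀ˢ e^{2iku} du. If |D(t-x) V(t)| ≤ q(t) for 0 ≤ x ≤ t with q integrable, Picard
iteration converges and gives |m| ≤ e^Q and |m - 1| ≤ e^Q - 1, where Q(x) = ∫ₓ^∞ q. Everything then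
depends on the choice of q. Taking q = t e^{2bt}|V|, which serves all k with Im k ≥ -b, 2b < a,
shows that F(k) = m(0,k) is analytic for Im k > -a/2. Interpolating between |D(s)| ≤ s e^{2bs} and
|D(s)| ≤ (1 + e^{2bs})/(2|k|) gives the quantitative bounds: an upper bound for |F| on the circle |k
- iA| = A + b, where Im k ≥ -b and |k| ≥ b, and, with b = 0, a lower bound for |F(iA)|.

Since Im k ≥ 0, a zero k with |k| ≤ R satisfies |k - iA|² ≤ A² + R². Jensen's inequality with radii
√(A² + R²) and A + b bounds the number of zeros (`totalMultiplicity_le_of_lt`), and b ↑ a/2 gives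
the theorem.

On the spectral side only inequalities are needed. Real zeros of F account for the spectral
singularities. For an eigenvalue k², Im k > 0, let u have height exactly n + 1 in the root subspace.
Green's identity, applied n + 1 times to the pairing with e(·,κ), yields (κ² - k²)^{n+1}⟨e(·,κ), u⟩
= -F(κ) P(κ² - k²) with a polynomial P, P(0) ≠ 0 (`exists_polynomial_of_mem_kerPow`). The pairing is
bounded near k, so F vanishes there to order n + 1. Eigenspaces are at most one-dimensional, so the
algebraic multiplicity is at most the order of the zero (`algMultiplicity_le`). There are no
eigenvalues in [0, ∞): this, and the constancy of Wronskians in general, is exploited through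
`wronskian_limit_eq_zero`, which replaces decay of derivatives at infinity by mere smallness of
values. -/

theorem absolutelyContinuousOnInterval_of_dist_le {X Y : Type*} [PseudoMetricSpace X]
    [PseudoMetricSpace Y] {f : ℝ → X} {g : ℝ → Y} {a b K : ℝ}
    (hf : AbsolutelyContinuousOnInterval f a b)
    (h : ∀ x ∈ uIcc a b, ∀ y ∈ uIcc a b, dist (g x) (g y) ≤ K * dist (f x) (f y)) :
    AbsolutelyContinuousOnInterval g a b := by
  unfold AbsolutelyContinuousOnInterval at hf ⊢
  refine squeeze_zero' (Eventually.of_forall fun _ => Finset.sum_nonneg fun _ _ => dist_nonneg) ?_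
    (by simpa using hf.const_mul K)
  rw [eventually_inf_principal]
  refine Eventually.of_forall fun E hE => ?_
  rw [Finset.mul_sum]
  exact Finset.sum_le_sum fun i hi => h _ (hE.1 i hi).1 _ (hE.1 i hi).2

/-- `U` is locally absolutely continuous on `[0, ∞)` with derivative `u`. -/
def IsPrimitive (U u : ℝ → E) : Prop :=
  (∀ x, 0 ≤ x → IntervalIntegrable u volume 0 x) ∧
    ∀ x, 0 ≤ x → U x = U 0 + ∫ t in (0 : ℝ)..x, u t

theorem IsPrimitive.intervalIntegrable {U u : ℝ → E} (h : IsPrimitive U u) {x y : ℝ}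
    (hx : 0 ≤ x) (hy : 0 ≤ y) : IntervalIntegrable u volume x y :=
  (h.1 x hx).symm.trans (h.1 y hy)

theorem IsPrimitive.sub_eq_integral {U u : ℝ → E} (h : IsPrimitive U u) {x y : ℝ}
    (hx : 0 ≤ x) (hy : 0 ≤ y) : U y - U x = ∫ t in x..y, u t := by
  rw [h.2 x hx, h.2 y hy, add_sub_add_left_eq_sub,
    intervalIntegral.integral_interval_sub_left (h.1 y hy) (h.1 x hx)]

/-- The increments of U are dominated by those of the scalar function ∫₀ˣ ‖u‖. -/
theorem IsPrimitive.absolutelyContinuousOnInterval {U u : ℝ → E} (h : IsPrimitive U u) {X : ℝ}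
    (hX : 0 ≤ X) : AbsolutelyContinuousOnInterval U 0 X := by
  refine absolutelyContinuousOnInterval_of_dist_le (K := 1)
    ((h.1 X hX).norm.absolutelyContinuousOnInterval_intervalIntegral left_mem_uIcc) ?_
  intro x hx y hy
  rw [uIcc_of_le hX] at hx hy
  rw [one_mul, dist_comm, dist_eq_norm, dist_comm (α := ℝ), Real.dist_eq,
    h.sub_eq_integral hx.1 hy.1,
    intervalIntegral.integral_interval_sub_left (h.1 y hy.1).norm (h.1 x hx.1).norm]
  exact intervalIntegral.norm_integral_le_abs_integral_norm

theorem IsPrimitive.continuousOn {U u : ℝ → E} (h : IsPrimitive U u) :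
    ContinuousOn U (Ici 0) := by
  intro x hx
  have hx0 : (0 : ℝ) ≤ x := hx
  have hc := (h.absolutelyContinuousOnInterval (by linarith : 0 ≤ x + 1)).continuousOn x
    (by rw [uIcc_of_le (by linarith)]; exact ⟨hx0, by linarith⟩)
  rw [uIcc_of_le (by linarith), ← Ici_inter_Iic] at hc
  exact (continuousWithinAt_inter (Iic_mem_nhds (by linarith))).1 hc

theorem IsPrimitive.ae_hasDerivAt [CompleteSpace E] {U u : ℝ → E} (h : IsPrimitive U u) :
    ∀ᵐ x, 0 < x → HasDerivAt U (u x) x := by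
  have hloc : ∀ n : ℕ, ∀ᵐ x, x ∈ Ioo (0 : ℝ) n → HasDerivAt U (u x) x := by
    intro n
    filter_upwards [(h.1 n n.cast_nonneg).ae_hasDerivAt_integral] with x hx hxn
    have := (hx (by rw [uIcc_of_le n.cast_nonneg]; exact Ioo_subset_Icc_self hxn) 0
      left_mem_uIcc).const_add (U 0)
    refine this.congr_of_eventuallyEq ?_
    filter_upwards [lt_mem_nhds hxn.1] with b hb
    exact h.2 b hb.le
  filter_upwards [ae_all_iff.2 hloc] with x hx hx0
  obtain ⟨n, hn⟩ := exists_nat_gt x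
  exact hx n ⟨hx0, hn⟩

/-- The difference of U and ∫₀ˣ u is absolutely continuous with derivative zero almost everywhere,
hence constant. This reduces the calculus rules below to their almost everywhere versions. -/
theorem isPrimitive_of_absolutelyContinuousOnInterval [CompleteSpace E] {U u : ℝ → E}
    (hU : ∀ X, 0 ≤ X → AbsolutelyContinuousOnInterval U 0 X)
    (hu : ∀ X, 0 ≤ X → IntervalIntegrable u volume 0 X)
    (hd : ∀ᵐ x, 0 < x → HasDerivAt U (u x) x) : IsPrimitive U u := by
  refine ⟨hu, fun X hX => ?_⟩
  let P : ℝ → E := fun x => ∫ t in (0 : ℝ)..x, u t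
  have hP : IsPrimitive P u := ⟨hu, fun x _ => by simp [P]⟩
  have hac := (hU X hX).sub (hP.absolutelyContinuousOnInterval hX)
  have h0 : ∀ᵐ x, x ∈ uIcc 0 X → HasDerivAt (U - P) 0 x := by
    have hne : ∀ᵐ x : ℝ, x ≠ 0 := by simp [ae_iff, measure_singleton]
    filter_upwards [hd, hP.ae_hasDerivAt, hne] with x h1 h2 h3 hx
    rw [uIcc_of_le hX] at hx
    have hx0 : 0 < x := lt_of_le_of_ne hx.1 (Ne.symm h3)
    simpa using (h1 hx0).sub (h2 hx0)
  obtain ⟨C, hC⟩ := hac.const_of_ae_hasDerivAt_zero h0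
  have e0 := hC 0 left_mem_uIcc
  have eX := hC X right_mem_uIcc
  simp only [Pi.sub_apply, P, intervalIntegral.integral_same, sub_zero] at e0 eX
  rw [e0, ← eX]
  abel

theorem isPrimitive_of_hasDerivWithinAt [CompleteSpace E] {U u : ℝ → E}
    (hd : ∀ x, 0 ≤ x → HasDerivWithinAt U (u x) (Ici 0) x) (hc : ContinuousOn u (Ici 0)) :
    IsPrimitive U u := by
  have hi : ∀ x, 0 ≤ x → IntervalIntegrable u volume 0 x := fun x hx =>
    (hc.mono (by rw [uIcc_of_le hx]; exact Icc_subset_Ici_self)).intervalIntegrable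
  refine ⟨hi, fun x hx => ?_⟩
  rw [intervalIntegral.integral_eq_sub_of_hasDerivAt_of_le hx
    (fun t ht => ((hd t ht.1).continuousWithinAt).mono Icc_subset_Ici_self)
    (fun t ht => (hd t ht.1.le).hasDerivAt (Ici_mem_nhds ht.1)) (hi x hx)]
  abel

theorem IsPrimitive.congr_right {U u v : ℝ → E} (h : IsPrimitive U u)
    (huv : ∀ x, 0 < x → u x = v x) : IsPrimitive U v := by
  have key : ∀ x, 0 ≤ x → EqOn u v (uIoc 0 x) := by
    intro x hx t ht
    rw [uIoc_of_le hx] at ht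
    exact huv t ht.1
  refine ⟨fun x hx => (intervalIntegrable_congr (key x hx)).1 (h.1 x hx), fun x hx => ?_⟩
  rw [h.2 x hx, intervalIntegral.integral_congr_ae (Eventually.of_forall fun t ht => key x hx ht)]

theorem IsPrimitive.sub {U u W w : ℝ → E} (h : IsPrimitive U u) (h' : IsPrimitive W w) :
    IsPrimitive (fun x => U x - W x) (fun x => u x - w x) := by
  refine ⟨fun x hx => (h.1 x hx).sub (h'.1 x hx), fun x hx => ?_⟩
  beta_reduce
  rw [intervalIntegral.integral_sub (h.1 x hx) (h'.1 x hx), h.2 x hx, h'.2 x hx]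
  abel

/-- Integration by parts for factors that are differentiable only almost everywhere, as is the
derivative of a solution when V is merely integrable. -/
theorem IsPrimitive.mul {U u W w : ℝ → ℂ} (h : IsPrimitive U u) (h' : IsPrimitive W w) :
    IsPrimitive (fun x => U x * W x) (fun x => u x * W x + U x * w x) := by
  refine isPrimitive_of_absolutelyContinuousOnInterval
    (fun X hX => (h.absolutelyContinuousOnInterval hX).smul (h'.absolutelyContinuousOnInterval hX))
    (fun X hX => ?_) ?_
  · have hs : uIcc 0 X ⊆ Ici 0 := by rw [uIcc_of_le hX]; exact Icc_subset_Ici_self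
    exact ((h.1 X hX).mul_continuousOn (h'.continuousOn.mono hs)).add
      ((h'.1 X hX).continuousOn_mul (h.continuousOn.mono hs))
  · filter_upwards [h.ae_hasDerivAt, h'.ae_hasDerivAt] with x h1 h2 hx
    exact (h1 hx).mul (h2 hx)

theorem IsPrimitive.const_mul {U u : ℝ → ℂ} (h : IsPrimitive U u) (c : ℂ) :
    IsPrimitive (fun x => c * U x) (fun x => c * u x) := by
  refine ⟨fun x hx => (h.1 x hx).const_mul c, fun x hx => ?_⟩
  beta_reduce
  rw [intervalIntegral.integral_const_mul, h.2 x hx]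
  ring

theorem IsPrimitive.rexp {U u : ℝ → ℝ} (h : IsPrimitive U u) :
    IsPrimitive (fun x => Real.exp (U x)) (fun x => Real.exp (U x) * u x) := by
  have hc : ContinuousOn (fun x => Real.exp (U x)) (Ici 0) := h.continuousOn.rexp
  refine isPrimitive_of_absolutelyContinuousOnInterval (fun X hX => ?_) (fun X hX => ?_) ?_
  · have hac := h.absolutelyContinuousOnInterval hX
    obtain ⟨C, hC⟩ := hac.exists_bound
    refine absolutelyContinuousOnInterval_of_dist_le (K := Real.exp C) hac ?_
    intro x hx y hy
    have hle : ∀ t ∈ uIcc 0 X, U t ∈ Iic C := fun t ht => (le_abs_self _).trans (hC t ht)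
    rw [dist_comm, dist_comm (U x), dist_eq_norm, dist_eq_norm]
    refine (convex_Iic C).norm_image_sub_le_of_norm_hasDerivWithin_le (f' := Real.exp)
      (fun s _ => (Real.hasDerivAt_exp s).hasDerivWithinAt) (fun s hs => ?_) (hle x hx) (hle y hy)
    rw [Real.norm_eq_abs, Real.abs_exp]
    exact Real.exp_le_exp.2 hs
  · exact (h.1 X hX).continuousOn_mul (hc.mono (by rw [uIcc_of_le hX]; exact Icc_subset_Ici_self))
  · filter_upwards [h.ae_hasDerivAt] with x h1 hx
    exact (h1 hx).exp

end Primitive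

/-! ### Integral inequalities and holomorphic parameter integrals -/

/-- A Volterra integral inequality of the first kind forces a nonnegative function to vanish. -/
theorem eq_zero_of_le_integral {q N : ℝ → ℝ} {X : ℝ} (hX : 0 ≤ X)
    (hq : ∀ x, 0 ≤ x → IntervalIntegrable q volume 0 x) (hq0 : ∀ x, 0 ≤ q x)
    (hN : ContinuousOn N (Icc 0 X)) (hN0 : ∀ x ∈ Icc 0 X, 0 ≤ N x)
    (h : ∀ x ∈ Icc 0 X, N x ≤ ∫ t in (0 : ℝ)..x, q t * N t) : ∀ x ∈ Icc 0 X, N x = 0 := by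
  -- The factor 2 makes integration against q lose a half: ∫₀ʸ q M e^Q = M (e^{Q y} - 1)/2. At a
  -- maximum point y of N e^{-Q}, where N = M e^Q, this forces M = 0.
  let Q : ℝ → ℝ := fun x => ∫ t in (0 : ℝ)..x, 2 * q t
  have hQ : IsPrimitive Q (fun t => 2 * q t) :=
    ⟨fun x hx => (hq x hx).const_mul 2, fun x _ => by simp [Q]⟩
  have hE := hQ.rexp
  have hQc : ContinuousOn Q (Icc 0 X) := hQ.continuousOn.mono Icc_subset_Ici_self
  obtain ⟨y, hy, hmax⟩ := isCompact_Icc.exists_isMaxOn (nonempty_Icc.2 hX)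
    (hN.mul (hQc.neg.rexp))
  have hmax' : ∀ x ∈ Icc 0 X, N x * Real.exp (-Q x) ≤ N y * Real.exp (-Q y) := fun x hx => hmax hx
  set M := N y * Real.exp (-Q y) with hM
  have hle : ∀ x ∈ Icc 0 X, N x ≤ M * Real.exp (Q x) := by
    intro x hx
    have := mul_le_mul_of_nonneg_right (hmax' x hx) (Real.exp_pos (Q x)).le
    rwa [mul_assoc, ← Real.exp_add, neg_add_cancel, Real.exp_zero, mul_one] at this
  have hM0 : 0 ≤ M := mul_nonneg (hN0 y hy) (Real.exp_pos _).le
  have hsub : uIcc 0 y ⊆ Icc 0 X := by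
    rw [uIcc_of_le hy.1]; exact Icc_subset_Icc_right hy.2
  have hint : ∫ t in (0 : ℝ)..y, q t * N t ≤ ∫ t in (0 : ℝ)..y,
      M / 2 * (Real.exp (Q t) * (2 * q t)) := by
    refine intervalIntegral.integral_mono_on hy.1
      ((hq y hy.1).mul_continuousOn (hN.mono hsub)) ((hE.1 y hy.1).const_mul _) fun t ht => ?_
    have := mul_le_mul_of_nonneg_left (hle t (hsub (by rwa [uIcc_of_le hy.1]))) (hq0 t)
    linarith
  rw [intervalIntegral.integral_const_mul, ← hE.sub_eq_integral le_rfl hy.1] at hint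
  have hQ0 : Q 0 = 0 := by simp [Q]
  rw [hQ0, Real.exp_zero] at hint
  have hNy : N y = M * Real.exp (Q y) := by
    rw [hM, mul_assoc, ← Real.exp_add, neg_add_cancel, Real.exp_zero, mul_one]
  have hfin := (h y hy).trans hint
  rw [hNy] at hfin
  have hMz : M = 0 := by
    have := Real.exp_pos (Q y)
    nlinarith [mul_nonneg hM0 this.le]
  intro x hx
  exact le_antisymm (by simpa [hMz] using hle x hx) (hN0 x hx)

/-- The tail version of the exponential integral: `∫ₓ^∞ q e^{cQ} = (e^{cQ(x)} - 1) / c` for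
`Q(x) = ∫ₓ^∞ q`. -/
theorem integral_Ioi_mul_exp_tail {q : ℝ → ℝ} (hq : IntegrableOn q (Ioi 0)) {c : ℝ} (hc : c ≠ 0)
    {x : ℝ} (hx : 0 ≤ x) :
    IntegrableOn (fun t => q t * Real.exp (c * ∫ s in Ioi t, q s)) (Ioi x) ∧
      ∫ t in Ioi x, q t * Real.exp (c * ∫ s in Ioi t, q s) =
        (Real.exp (c * ∫ s in Ioi x, q s) - 1) / c := by
  set Q : ℝ → ℝ := fun t => ∫ s in Ioi t, q s with hQdef
  have hqi : ∀ y, 0 ≤ y → IntegrableOn q (Ioi y) := fun y hy => hq.mono_set (Ioi_subset_Ioi hy)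
  have hii : ∀ y, 0 ≤ y → IntervalIntegrable q volume 0 y := fun y hy =>
    (intervalIntegrable_iff_integrableOn_Ioc_of_le hy).2 (hq.mono_set Ioc_subset_Ioi_self)
  have hQ : IsPrimitive (fun t => c * Q t) (fun t => -c * q t) := by
    refine ⟨fun y hy => (hii y hy).const_mul _, fun y hy => ?_⟩
    have := intervalIntegral.integral_interval_add_Ioi (hqi 0 le_rfl) (hqi y hy)
    simp only [hQdef]
    rw [intervalIntegral.integral_const_mul, ← this]
    ring
  have hE := hQ.rexp
  have hQc : ContinuousOn (fun t => Real.exp (c * Q t)) (Ici 0) := hE.continuousOn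
  have hQt : Tendsto Q atTop (𝓝 0) := by
    have h1 := intervalIntegral_tendsto_integral_Ioi 0 hq tendsto_id
    have h2 : Tendsto (fun y => Q 0 - ∫ t in (0 : ℝ)..y, q t) atTop (𝓝 0) := by
      simpa [hQdef] using h1.const_sub (Q 0)
    refine h2.congr' ?_
    filter_upwards [eventually_ge_atTop 0] with y hy
    have := intervalIntegral.integral_interval_add_Ioi (hqi 0 le_rfl) (hqi y hy)
    simp only [hQdef]
    linarith
  have hbdd : ∃ C, ∀ t ∈ Ici (0 : ℝ), ‖Real.exp (c * Q t)‖ ≤ C := by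
    refine ⟨Real.exp (|c| * ∫ s in Ioi 0, ‖q s‖), fun t ht => ?_⟩
    rw [Real.norm_eq_abs, Real.abs_exp]
    refine Real.exp_le_exp.2 ((le_abs_self _).trans ?_)
    rw [abs_mul]
    gcongr
    refine (norm_integral_le_integral_norm q).trans ?_
    exact setIntegral_mono_set hq.norm (Eventually.of_forall fun _ => norm_nonneg _)
      (Ioi_subset_Ioi ht).eventuallyLE
  obtain ⟨C, hC⟩ := hbdd
  have hI : IntegrableOn (fun t => q t * Real.exp (c * Q t)) (Ioi x) := by
    refine Integrable.mul_bdd (hqi x hx) ?_ (c := C) ?_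
    · exact (hQc.mono (Ioi_subset_Ici hx)).aestronglyMeasurable measurableSet_Ioi
    · filter_upwards [ae_restrict_mem measurableSet_Ioi] with t ht
      exact hC t (hx.trans (le_of_lt ht))
  refine ⟨hI, ?_⟩
  have h1 := intervalIntegral_tendsto_integral_Ioi x hI tendsto_id
  have h2 : Tendsto (fun y => (Real.exp (c * Q x) - Real.exp (c * Q y)) / c) atTop
      (𝓝 ((Real.exp (c * Q x) - Real.exp (c * 0)) / c)) := by
    refine ((tendsto_const_nhds (x := Real.exp (c * Q x))).sub ?_).div_const c
    exact (Real.continuous_exp.tendsto _).comp (hQt.const_mul c)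
  rw [mul_zero, Real.exp_zero] at h2
  refine tendsto_nhds_unique h1 (h2.congr' ?_)
  filter_upwards [eventually_ge_atTop 0] with y hy
  have h3 := hE.sub_eq_integral hx hy
  have h4 : ∫ t in x..y, Real.exp (c * Q t) * (-c * q t) =
      -c * ∫ t in x..y, q t * Real.exp (c * Q t) := by
    rw [← intervalIntegral.integral_const_mul]
    exact intervalIntegral.integral_congr fun t _ => by ring
  rw [h4] at h3
  simp only [id]
  field_simp
  linarith

/-- An integral of holomorphic functions with a common integrable bound is holomorphic. -/
theorem differentiableOn_integral_of_norm_le {α : Type*} [MeasurableSpace α] {μ : Measure α}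
    {U : Set ℂ} (hU : IsOpen U) {F : ℂ → α → ℂ} {g : α → ℝ}
    (hm : ∀ k ∈ U, AEStronglyMeasurable (F k) μ)
    (hd : ∀ᵐ t ∂μ, DifferentiableOn ℂ (fun k => F k t) U)
    (hb : ∀ᵐ t ∂μ, ∀ k ∈ U, ‖F k t‖ ≤ g t) (hg : Integrable g μ) :
    DifferentiableOn ℂ (fun k => ∫ t, F k t ∂μ) U := by
  intro k₀ hk₀
  obtain ⟨ε, hε, hball⟩ := Metric.isOpen_iff.1 hU k₀ hk₀
  set r := ε / 2 with hr
  have hr0 : 0 < r := by positivity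
  have hsub : ∀ x ∈ Metric.ball k₀ r, Metric.closedBall x r ⊆ U := by
    intro x hx y hy
    refine hball ?_
    rw [Metric.mem_ball] at hx ⊢
    have := dist_triangle y x k₀
    rw [Metric.mem_closedBall] at hy
    linarith
  have hball' : Metric.ball k₀ r ⊆ U := fun x hx =>
    hsub x hx (Metric.mem_closedBall_self hr0.le)
  have hderiv : ∀ᵐ t ∂μ, ∀ x ∈ Metric.ball k₀ r,
      HasDerivAt (fun k => F k t) (deriv (fun k => F k t) x) x := by
    filter_upwards [hd] with t ht x hx
    exact ((ht x (hball' hx)).differentiableAt (hU.mem_nhds (hball' hx))).hasDerivAt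
  have key := hasDerivAt_integral_of_dominated_loc_of_deriv_le (μ := μ) (F := F)
    (F' := fun x t => deriv (fun k => F k t) x) (bound := fun t => g t / r)
    (Metric.ball_mem_nhds k₀ hr0) ?_ ?_ ?_ ?_ (hg.div_const r) hderiv
  · exact key.2.differentiableAt.differentiableWithinAt
  · filter_upwards [hU.mem_nhds hk₀] with k hk using hm k hk
  · exact hg.mono' (hm k₀ hk₀) (hb.mono fun t ht => ht k₀ hk₀)
  -- Measurability of the derivative in t: it is a limit of difference quotients along k₀ + 1/(n+1),
  -- started late enough for the points to lie in U.
  · have hlim : Tendsto (fun n : ℕ => k₀ + ((1 / ((n : ℝ) + 1) : ℝ) : ℂ)) atTop (𝓝[≠] k₀) := by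
      refine tendsto_nhdsWithin_iff.2 ⟨?_, Eventually.of_forall fun n => ?_⟩
      · have := (Complex.continuous_ofReal.tendsto 0).comp
          (tendsto_one_div_add_atTop_nhds_zero_nat (𝕜 := ℝ))
        simpa using this.const_add k₀
      · simp only [mem_compl_iff, mem_singleton_iff, add_eq_left, Complex.ofReal_eq_zero]
        positivity
    obtain ⟨N, hN⟩ := eventually_atTop.1
      ((tendsto_nhdsWithin_iff.1 hlim).1.eventually (hU.mem_nhds hk₀))
    refine aestronglyMeasurable_of_tendsto_ae atTop
      (f := fun (n : ℕ) t => slope (fun k => F k t) k₀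
        (k₀ + ((1 / (((n + N : ℕ) : ℝ) + 1) : ℝ) : ℂ))) (fun n => ?_) ?_
    · simp only [slope_def_field]
      have := ((hm _ (hN (n + N) (by omega))).sub (hm k₀ hk₀)).mul_const
        ((k₀ + ((1 / (((n + N : ℕ) : ℝ) + 1) : ℝ) : ℂ) - k₀)⁻¹)
      simpa [div_eq_mul_inv] using this
    · filter_upwards [hderiv] with t ht
      have h1 := hasDerivAt_iff_tendsto_slope.1 (ht k₀ (Metric.mem_ball_self hr0))
      exact (h1.comp hlim).comp (tendsto_add_atTop_nat N)
  -- Cauchy's estimate on a circle of radius r turns the bound g into the bound g / r for the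
  -- derivative.
  · filter_upwards [hd, hb] with t h1 h2 x hx
    refine Complex.norm_deriv_le_of_forall_mem_sphere_norm_le hr0 ?_ fun z hz =>
      h2 z (hsub x hx (Metric.sphere_subset_closedBall hz))
    refine (h1.mono ?_).diffContOnCl
    rw [closure_ball x hr0.ne']
    exact hsub x hx

/-! ### The Volterra kernel and its bounds -/

/-- The kernel `∫₀ˢ e^{2iku} du = (e^{2iks} - 1) / (2ik)`. -/
def volterraKernel (k : ℂ) (s : ℝ) : ℂ :=
  s * dslope Complex.exp 0 (2 * Complex.I * k * s)

/-- The divided difference removes the singularity of (e^w - 1)/w, so the kernel is entire in k and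
k = 0 needs no separate treatment. -/
theorem differentiable_dslope_exp : Differentiable ℂ (dslope Complex.exp 0) := by
  rw [← differentiableOn_univ, Complex.differentiableOn_dslope univ_mem]
  exact Complex.differentiable_exp.differentiableOn

theorem volterraKernel_mul (k : ℂ) (s : ℝ) :
    2 * Complex.I * k * volterraKernel k s = Complex.exp (2 * Complex.I * k * s) - 1 := by
  have := sub_smul_dslope Complex.exp 0 (2 * Complex.I * k * s)
  rw [sub_zero, smul_eq_mul, Complex.exp_zero] at this
  rw [← this, volterraKernel]
  ring

@[simp]
theorem volterraKernel_zero_right (k : ℂ) : volterraKernel k 0 = 0 := by simp [volterraKernel]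

theorem volterraKernel_zero_left (s : ℝ) : volterraKernel 0 s = s := by
  simp [volterraKernel]

theorem differentiable_volterraKernel (s : ℝ) : Differentiable ℂ fun k => volterraKernel k s := by
  unfold volterraKernel
  exact (differentiable_dslope_exp.comp (by fun_prop :
    Differentiable ℂ fun k : ℂ => 2 * Complex.I * k * s)).const_mul _

theorem hasDerivAt_volterraKernel (k : ℂ) (s : ℝ) :
    HasDerivAt (volterraKernel k) (Complex.exp (2 * Complex.I * k * s)) s := by
  rcases eq_or_ne k 0 with rfl | hk
  · have : volterraKernel 0 = fun s : ℝ => (s : ℂ) := funext volterraKernel_zero_left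
    rw [this]
    simpa using (hasDerivAt_id s).ofReal_comp
  · have h2 : 2 * Complex.I * k ≠ 0 := by simp [hk]
    have : volterraKernel k = fun s : ℝ =>
        (Complex.exp (2 * Complex.I * k * s) - 1) / (2 * Complex.I * k) := by
      funext s
      rw [← volterraKernel_mul, mul_div_cancel_left₀ _ h2]
    rw [this]
    have h1 : HasDerivAt (fun s : ℝ => 2 * Complex.I * k * (s : ℂ)) (2 * Complex.I * k) s := by
      simpa using ((hasDerivAt_id s).ofReal_comp).const_mul (2 * Complex.I * k)
    have h3 := (h1.cexp.sub_const 1).div_const (2 * Complex.I * k)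
    rwa [mul_div_assoc, div_self h2, mul_one] at h3

theorem continuous_volterraKernel (k : ℂ) : Continuous (volterraKernel k) :=
  continuous_iff_continuousAt.2 fun s => (hasDerivAt_volterraKernel k s).continuousAt

theorem norm_cexp_two_I_mul (k : ℂ) (s : ℝ) :
    ‖Complex.exp (2 * Complex.I * k * s)‖ = Real.exp (-2 * k.im * s) := by
  rw [Complex.norm_exp]
  congr 1
  simp

theorem norm_cexp_two_I_mul_le {k : ℂ} {b s t : ℝ} (hb : 0 ≤ b) (hk : -b ≤ k.im) (hs : 0 ≤ s)
    (hst : s ≤ t) : ‖Complex.exp (2 * Complex.I * k * s)‖ ≤ Real.exp (2 * b * t) := by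
  rw [norm_cexp_two_I_mul]
  refine Real.exp_le_exp.2 ?_
  nlinarith [mul_le_mul_of_nonneg_right hk hs, mul_le_mul_of_nonneg_left hst hb]

theorem norm_volterraKernel_le_mul_exp {k : ℂ} {b s : ℝ} (hb : 0 ≤ b) (hk : -b ≤ k.im)
    (hs : 0 ≤ s) : ‖volterraKernel k s‖ ≤ s * Real.exp (2 * b * s) := by
  have := (convex_Icc 0 s).norm_image_sub_le_of_norm_hasDerivWithin_le
    (f := volterraKernel k) (fun u _ => (hasDerivAt_volterraKernel k u).hasDerivWithinAt)
    (fun u hu => norm_cexp_two_I_mul_le hb hk hu.1 hu.2)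
    (left_mem_Icc.2 hs) (right_mem_Icc.2 hs)
  rwa [volterraKernel_zero_right, sub_zero, sub_zero, Real.norm_of_nonneg hs, mul_comm] at this

theorem norm_volterraKernel_le_div {k : ℂ} {b s : ℝ} (hb : 0 ≤ b) (hk : -b ≤ k.im)
    (hs : 0 ≤ s) (hk0 : k ≠ 0) :
    ‖volterraKernel k s‖ ≤ (1 + Real.exp (2 * b * s)) / (2 * ‖k‖) := by
  have h2 : 0 < 2 * ‖k‖ := by positivity
  rw [le_div_iff₀ h2]
  have h := congrArg norm (volterraKernel_mul k s)
  rw [norm_mul, norm_mul, norm_mul, Complex.norm_I, Complex.norm_ofNat, mul_one] at h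
  rw [mul_comm, h, add_comm]
  refine (norm_sub_le _ _).trans ?_
  rw [norm_one]
  gcongr
  exact norm_cexp_two_I_mul_le hb hk hs le_rfl

/-- Interpolation between the two bounds on the kernel. -/
theorem norm_volterraKernel_le_rpow {k : ℂ} {b c β s : ℝ} (hb : 0 ≤ b) (hk : -b ≤ k.im)
    (hs : 0 ≤ s) (hc : 0 < c) (hkc : c ≤ ‖k‖) (hβ : β ∈ Ico (0 : ℝ) 1) :
    ‖volterraKernel k s‖ ≤ 1 / (2 * c) ^ (1 - β) * (s ^ β * (1 + Real.exp (2 * b * s))) := by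
  have hk0 : k ≠ 0 := by
    rintro rfl
    simp at hkc
    linarith
  set G := 1 + Real.exp (2 * b * s) with hG
  have hG0 : 0 < G := by positivity
  set D := ‖volterraKernel k s‖ with hD
  have hD0 : 0 ≤ D := norm_nonneg _
  have h1 : D ≤ s * G :=
    (norm_volterraKernel_le_mul_exp hb hk hs).trans
      (mul_le_mul_of_nonneg_left (by rw [hG]; linarith) hs)
  have h2 : D ≤ G / (2 * c) :=
    (norm_volterraKernel_le_div hb hk hs hk0).trans (by rw [hG]; gcongr)
  have hβ1 : 0 ≤ 1 - β := by linarith [hβ.2]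
  -- The bound growing linearly in s gets the weight β and the bound decaying in |k| the weight 1 -
  -- β.
  calc D = D ^ β * D ^ (1 - β) := by
        rw [← Real.rpow_add_of_nonneg hD0 hβ.1 hβ1]; simp
    _ ≤ (s * G) ^ β * (G / (2 * c)) ^ (1 - β) := by
        gcongr
        exact hβ.1
    _ = 1 / (2 * c) ^ (1 - β) * (s ^ β * G) := by
        rw [Real.mul_rpow hs hG0.le, Real.div_rpow hG0.le (by positivity)]
        have : G ^ β * G ^ (1 - β) = G := by rw [← Real.rpow_add hG0]; simp
        calc s ^ β * G ^ β * (G ^ (1 - β) / (2 * c) ^ (1 - β))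
            = 1 / (2 * c) ^ (1 - β) * (s ^ β * (G ^ β * G ^ (1 - β))) := by ring
          _ = _ := by rw [this]

/-! ### The Volterra equation and Picard iteration -/

/-- An integrable bound for the Volterra operator with potential `V` at spectral parameter `k`. -/
structure KernelBound (V : ℝ → ℂ) (k : ℂ) (q : ℝ → ℝ) : Prop where
  integrable : IntegrableOn q (Ioi 0)
  meas : AEStronglyMeasurable V (volume.restrict (Ioi 0))
  nonneg : ∀ t, 0 < t → 0 ≤ q t
  le : ∀ x t, 0 ≤ x → x ≤ t → 0 < t → ‖volterraKernel k (t - x) * V t‖ ≤ q t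

/-- The Volterra operator `f ↦ ∫ₓ^∞ D(t - x) V(t) f(t) dt`. -/
def volterra (V : ℝ → ℂ) (k : ℂ) (f : ℝ → ℂ) (x : ℝ) : ℂ :=
  -- The kernel vanishes at 0, so truncating t - x at 0 replaces the range (x, ∞) by one independent
  -- of x. Continuity and differentiation in x then need no moving endpoint.
  ∫ t in Ioi (0 : ℝ), volterraKernel k (max (t - x) 0) * V t * f t

/-- The tail integral `∫ₓ^∞ q`. -/
def tail (q : ℝ → ℝ) (x : ℝ) : ℝ := ∫ s in Ioi x, q s

section Bound

variable {V : ℝ → ℂ} {k : ℂ} {q : ℝ → ℝ}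

theorem KernelBound.tail_nonneg (h : KernelBound V k q) {x : ℝ} (hx : 0 ≤ x) : 0 ≤ tail q x :=
  setIntegral_nonneg measurableSet_Ioi fun t ht => h.nonneg t (lt_of_le_of_lt hx ht)

theorem KernelBound.tail_le (h : KernelBound V k q) {x : ℝ} (hx : 0 ≤ x) :
    tail q x ≤ tail q 0 := by
  refine setIntegral_mono_set h.integrable ?_ (Ioi_subset_Ioi hx).eventuallyLE
  filter_upwards [ae_restrict_mem measurableSet_Ioi] with t ht using h.nonneg t ht

theorem tendsto_tail_atTop (hq : IntegrableOn q (Ioi 0)) : Tendsto (tail q) atTop (𝓝 0) := by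
  have h1 := intervalIntegral_tendsto_integral_Ioi 0 hq tendsto_id
  have h2 : Tendsto (fun y => tail q 0 - ∫ t in (0 : ℝ)..y, q t) atTop (𝓝 0) := by
    simpa [tail] using h1.const_sub (tail q 0)
  refine h2.congr' ?_
  filter_upwards [eventually_ge_atTop 0] with y hy
  have := intervalIntegral.integral_interval_add_Ioi hq (hq.mono_set (Ioi_subset_Ioi hy))
  simp only [tail]
  linarith

theorem KernelBound.norm_kernel_le (h : KernelBound V k q) {x t : ℝ} (hx : 0 ≤ x) (ht : 0 < t) :
    ‖volterraKernel k (max (t - x) 0) * V t‖ ≤ (Ioi x).indicator q t := by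
  by_cases hxt : x < t
  · rw [indicator_of_mem (mem_Ioi.2 hxt), max_eq_left (by linarith)]
    exact h.le x t hx hxt.le ht
  · rw [indicator_of_notMem (by simpa using hxt), max_eq_right (by linarith)]
    simp

theorem KernelBound.norm_kernel_le' (h : KernelBound V k q) {x t : ℝ} (hx : 0 ≤ x) (ht : 0 < t) :
    ‖volterraKernel k (max (t - x) 0) * V t‖ ≤ q t :=
  (h.norm_kernel_le hx ht).trans (indicator_le_self' (fun _ _ => h.nonneg t ht) t)

theorem KernelBound.aestronglyMeasurable (h : KernelBound V k q) (x : ℝ) {f : ℝ → ℂ}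
    (hf : AEStronglyMeasurable f (volume.restrict (Ioi 0))) :
    AEStronglyMeasurable (fun t => volterraKernel k (max (t - x) 0) * V t * f t)
      (volume.restrict (Ioi 0)) := by
  refine AEStronglyMeasurable.mul (AEStronglyMeasurable.mul ?_ h.meas) hf
  exact ((continuous_volterraKernel k).comp (by fun_prop)).aestronglyMeasurable

theorem KernelBound.integrable_of_bdd (h : KernelBound V k q) {x C : ℝ} (hx : 0 ≤ x) {f : ℝ → ℂ}
    (hf : AEStronglyMeasurable f (volume.restrict (Ioi 0))) (hC : ∀ t, 0 ≤ t → ‖f t‖ ≤ C) :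
    IntegrableOn (fun t => volterraKernel k (max (t - x) 0) * V t * f t) (Ioi 0) := by
  refine (h.integrable.mul_const C).mono' (h.aestronglyMeasurable x hf) ?_
  filter_upwards [ae_restrict_mem measurableSet_Ioi] with t ht
  rw [norm_mul]
  exact mul_le_mul (h.norm_kernel_le' hx ht) (hC t (le_of_lt ht)) (norm_nonneg _) (h.nonneg t ht)

theorem KernelBound.norm_volterra_le (h : KernelBound V k q) {x : ℝ} (hx : 0 ≤ x) {f : ℝ → ℂ}
    {g : ℝ → ℝ} (hg : IntegrableOn (fun t => q t * g t) (Ioi x))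
    (hfg : ∀ t, 0 ≤ t → ‖f t‖ ≤ g t) :
    ‖volterra V k f x‖ ≤ ∫ t in Ioi x, q t * g t := by
  have h1 : ∫ t in Ioi x, q t * g t =
      ∫ t in Ioi (0 : ℝ), (Ioi x).indicator (fun t => q t * g t) t := by
    rw [setIntegral_indicator measurableSet_Ioi, inter_eq_right.2 (Ioi_subset_Ioi hx)]
  rw [h1]
  refine norm_integral_le_of_norm_le ?_ ?_
  · rw [integrable_indicator_iff measurableSet_Ioi, IntegrableOn,
      Measure.restrict_restrict measurableSet_Ioi, inter_eq_left.2 (Ioi_subset_Ioi hx)]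
    exact hg
  · filter_upwards [ae_restrict_mem measurableSet_Ioi] with t ht
    rw [norm_mul]
    refine (mul_le_mul_of_nonneg_right (h.norm_kernel_le hx ht) (norm_nonneg _)).trans ?_
    by_cases hxt : t ∈ Ioi x
    · rw [indicator_of_mem hxt, indicator_of_mem hxt]
      exact mul_le_mul_of_nonneg_left (hfg t (le_of_lt ht)) (h.nonneg t ht)
    · rw [indicator_of_notMem hxt, indicator_of_notMem hxt, zero_mul]

theorem KernelBound.continuousOn_volterra (h : KernelBound V k q) {C : ℝ} {f : ℝ → ℂ}
    (hf : AEStronglyMeasurable f (volume.restrict (Ioi 0))) (hC : ∀ t, 0 ≤ t → ‖f t‖ ≤ C) :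
    ContinuousOn (volterra V k f) (Ici 0) := by
  refine continuousOn_of_dominated (bound := fun t => q t * C)
    (fun x _ => h.aestronglyMeasurable x hf) (fun x hx => ?_) (h.integrable.mul_const C) ?_
  · filter_upwards [ae_restrict_mem measurableSet_Ioi] with t ht
    rw [norm_mul]
    exact mul_le_mul (h.norm_kernel_le' hx ht) (hC t (le_of_lt ht)) (norm_nonneg _) (h.nonneg t ht)
  · refine Eventually.of_forall fun t => Continuous.continuousOn ?_
    exact (((continuous_volterraKernel k).comp (by fun_prop)).mul_const _).mul_const _

end Bound

/-- Picard iterates for the Volterra equation `m = 1 + volterra V k m`. -/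
def jostIter (V : ℝ → ℂ) (k : ℂ) : ℕ → ℝ → ℂ
  | 0 => fun _ => 1
  | n + 1 => fun x => 1 + volterra V k (jostIter V k n) x

/-- The factor `m(x, k) = e^{-ikx} e(x, k)` of the Jost solution. -/
def jostFactor (V : ℝ → ℂ) (k : ℂ) (x : ℝ) : ℂ := limUnder atTop fun n => jostIter V k n x

section Jost

variable {V : ℝ → ℂ} {k : ℂ} {q : ℝ → ℝ}

/-- The bound reproduces itself: 1 + ∫ₓ^∞ q e^{Q} = e^{Q(x)} for the tail Q of q. -/
theorem KernelBound.jostIter_aux (h : KernelBound V k q) (n : ℕ) :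
    ContinuousOn (jostIter V k n) (Ici 0) ∧
      ∀ x, 0 ≤ x → ‖jostIter V k n x‖ ≤ Real.exp (tail q x) := by
  induction n with
  | zero =>
    refine ⟨continuousOn_const, fun x hx => ?_⟩
    simpa [jostIter] using h.tail_nonneg hx
  | succ n ih =>
    refine ⟨continuousOn_const.add (h.continuousOn_volterra (C := Real.exp (tail q 0))
      ((ih.1.mono Ioi_subset_Ici_self).aestronglyMeasurable measurableSet_Ioi)
      fun t ht => (ih.2 t ht).trans (Real.exp_le_exp.2 (h.tail_le ht))), fun x hx => ?_⟩
    have hE := integral_Ioi_mul_exp_tail h.integrable one_ne_zero hx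
    simp only [one_mul, div_one] at hE
    have hb := h.norm_volterra_le hx hE.1 ih.2
    rw [hE.2] at hb
    refine (norm_add_le _ _).trans ?_
    rw [norm_one]
    simp only [tail] at hb ⊢
    linarith

theorem KernelBound.continuousOn_jostIter (h : KernelBound V k q) (n : ℕ) :
    ContinuousOn (jostIter V k n) (Ici 0) := (h.jostIter_aux n).1

theorem KernelBound.norm_jostIter_le (h : KernelBound V k q) (n : ℕ) {x : ℝ} (hx : 0 ≤ x) :
    ‖jostIter V k n x‖ ≤ Real.exp (tail q x) := (h.jostIter_aux n).2 x hx

theorem KernelBound.norm_jostIter_le_const (h : KernelBound V k q) (n : ℕ) {x : ℝ} (hx : 0 ≤ x) :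
    ‖jostIter V k n x‖ ≤ Real.exp (tail q 0) :=
  (h.norm_jostIter_le n hx).trans (Real.exp_le_exp.2 (h.tail_le hx))

theorem KernelBound.aestronglyMeasurable_jostIter (h : KernelBound V k q) (n : ℕ) :
    AEStronglyMeasurable (jostIter V k n) (volume.restrict (Ioi 0)) :=
  ((h.continuousOn_jostIter n).mono Ioi_subset_Ici_self).aestronglyMeasurable measurableSet_Ioi

/-- With the weight e^{2Q} the Volterra operator contracts by 1/2, since ∫ₓ^∞ q e^{2Q} = (e^{2Q(x)}
- 1)/2. The convergence is therefore geometric, uniformly in x and in all k that share the same q.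
-/
theorem KernelBound.norm_jostIter_sub_le (h : KernelBound V k q) (n : ℕ) :
    ∀ x, 0 ≤ x → ‖jostIter V k (n + 1) x - jostIter V k n x‖ ≤
      (1 / 2) ^ n * Real.exp (2 * tail q x) := by
  induction n with
  | zero =>
    intro x hx
    have hb := h.norm_volterra_le (f := fun _ => 1) (g := fun _ => 1) hx
      (by simpa using h.integrable.mono_set (Ioi_subset_Ioi hx)) (by simp)
    have h0 := h.tail_nonneg hx
    have h1 := Real.add_one_le_exp (2 * tail q x)
    simp only [mul_one] at hb
    change _ ≤ tail q x at hb
    have h2 : jostIter V k (0 + 1) x - jostIter V k 0 x = volterra V k (fun _ => 1) x := by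
      simp [jostIter]
    rw [h2, pow_zero, one_mul]
    linarith
  | succ n ih =>
    intro x hx
    have hE := integral_Ioi_mul_exp_tail h.integrable two_ne_zero hx
    have hlin : jostIter V k (n + 1 + 1) x - jostIter V k (n + 1) x =
        volterra V k (fun t => jostIter V k (n + 1) t - jostIter V k n t) x := by
      have e1 : jostIter V k (n + 1 + 1) x = 1 + volterra V k (jostIter V k (n + 1)) x := rfl
      have e2 : jostIter V k (n + 1) x = 1 + volterra V k (jostIter V k n) x := rfl
      rw [e1, e2, add_sub_add_left_eq_sub]
      unfold volterra
      rw [← integral_sub]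
      · exact integral_congr_ae (Eventually.of_forall fun t => by ring)
      · exact h.integrable_of_bdd hx (h.aestronglyMeasurable_jostIter _)
          fun t ht => h.norm_jostIter_le_const _ ht
      · exact h.integrable_of_bdd hx (h.aestronglyMeasurable_jostIter _)
          fun t ht => h.norm_jostIter_le_const _ ht
    have hi : IntegrableOn (fun t => q t * ((1 / 2) ^ n * Real.exp (2 * tail q t))) (Ioi x) := by
      refine (hE.1.const_mul ((1 / 2) ^ n)).congr (Eventually.of_forall fun t => ?_)
      simp only [tail]
      ring
    have hb := h.norm_volterra_le hx hi ih
    rw [hlin]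
    refine hb.trans ?_
    have hval : ∫ t in Ioi x, q t * ((1 / 2) ^ n * Real.exp (2 * tail q t)) =
        (1 / 2) ^ n * ((Real.exp (2 * tail q x) - 1) / 2) := by
      rw [← show _ = (Real.exp (2 * tail q x) - 1) / 2 from hE.2, ← integral_const_mul]
      refine integral_congr_ae (Eventually.of_forall fun t => ?_)
      simp only [tail]
      ring
    rw [hval, pow_succ]
    have : (0 : ℝ) < (1 / 2) ^ n := by positivity
    nlinarith

theorem KernelBound.tendsto_jostIter (h : KernelBound V k q) {x : ℝ} (hx : 0 ≤ x) :
    Tendsto (fun n => jostIter V k n x) atTop (𝓝 (jostFactor V k x)) := by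
  refine (cauchySeq_of_le_geometric (1 / 2) (Real.exp (2 * tail q x)) (by norm_num)
    fun n => ?_).tendsto_limUnder
  rw [dist_comm, dist_eq_norm, mul_comm]
  exact h.norm_jostIter_sub_le n x hx

theorem KernelBound.dist_jostIter_le (h : KernelBound V k q) {x : ℝ} (hx : 0 ≤ x) (n : ℕ) :
    dist (jostIter V k n x) (jostFactor V k x) ≤ 2 * Real.exp (2 * tail q 0) * (1 / 2) ^ n := by
  have := dist_le_of_le_geometric_of_tendsto (1 / 2) (Real.exp (2 * tail q x)) (by norm_num)
    (fun n => by
      rw [dist_comm, dist_eq_norm, mul_comm]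
      exact h.norm_jostIter_sub_le n x hx) (h.tendsto_jostIter hx) n
  have h1 : Real.exp (2 * tail q x) ≤ Real.exp (2 * tail q 0) :=
    Real.exp_le_exp.2 (by linarith [h.tail_le hx])
  refine this.trans (le_of_eq_of_le (by ring : _ = 2 * Real.exp (2 * tail q x) * (1 / 2) ^ n) ?_)
  gcongr

theorem KernelBound.norm_jostFactor_le (h : KernelBound V k q) {x : ℝ} (hx : 0 ≤ x) :
    ‖jostFactor V k x‖ ≤ Real.exp (tail q x) :=
  le_of_tendsto (h.tendsto_jostIter hx).norm
    (Eventually.of_forall fun n => h.norm_jostIter_le n hx)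

theorem KernelBound.norm_jostFactor_le_const (h : KernelBound V k q) {x : ℝ} (hx : 0 ≤ x) :
    ‖jostFactor V k x‖ ≤ Real.exp (tail q 0) :=
  (h.norm_jostFactor_le hx).trans (Real.exp_le_exp.2 (h.tail_le hx))

theorem KernelBound.continuousOn_jostFactor (h : KernelBound V k q) :
    ContinuousOn (jostFactor V k) (Ici 0) := by
  have hu : TendstoUniformlyOn (jostIter V k) (jostFactor V k) atTop (Ici 0) := by
    rw [Metric.tendstoUniformlyOn_iff]
    intro ε hε
    have ht : Tendsto (fun n : ℕ => 2 * Real.exp (2 * tail q 0) * (1 / 2 : ℝ) ^ n) atTop (𝓝 0) := by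
      simpa using (tendsto_pow_atTop_nhds_zero_of_lt_one (by norm_num : (0 : ℝ) ≤ 1 / 2)
        (by norm_num)).const_mul (2 * Real.exp (2 * tail q 0))
    filter_upwards [ht.eventually (gt_mem_nhds hε)] with n hn x hx
    rw [dist_comm]
    exact (h.dist_jostIter_le hx n).trans_lt hn
  exact hu.continuousOn (Eventually.of_forall h.continuousOn_jostIter).frequently

theorem KernelBound.aestronglyMeasurable_jostFactor (h : KernelBound V k q) :
    AEStronglyMeasurable (jostFactor V k) (volume.restrict (Ioi 0)) :=
  (h.continuousOn_jostFactor.mono Ioi_subset_Ici_self).aestronglyMeasurable measurableSet_Ioi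

/-- The Volterra integral equation for the Jost factor. -/
theorem KernelBound.jostFactor_eq (h : KernelBound V k q) {x : ℝ} (hx : 0 ≤ x) :
    jostFactor V k x = 1 + volterra V k (jostFactor V k) x := by
  refine tendsto_nhds_unique ((h.tendsto_jostIter hx).comp (tendsto_add_atTop_nat 1)) ?_
  change Tendsto (fun n => 1 + volterra V k (jostIter V k n) x) atTop _
  refine Tendsto.const_add 1 ?_
  refine tendsto_integral_of_dominated_convergence (fun t => q t * Real.exp (tail q 0))
    (fun n => h.aestronglyMeasurable x (h.aestronglyMeasurable_jostIter n))
    (h.integrable.mul_const _) (fun n => ?_) ?_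
  · filter_upwards [ae_restrict_mem measurableSet_Ioi] with t ht
    rw [norm_mul]
    exact mul_le_mul (h.norm_kernel_le' hx ht) (h.norm_jostIter_le_const n (le_of_lt ht))
      (norm_nonneg _) (h.nonneg t ht)
  · filter_upwards [ae_restrict_mem measurableSet_Ioi] with t ht
    exact (h.tendsto_jostIter (le_of_lt ht)).const_mul _

/-- The value e^Q - 1 is the integral of q e^Q in the Volterra equation. It gives the limit 1 at
infinity, the bound on the zeros, and the lower bound at iA. -/
theorem KernelBound.norm_jostFactor_sub_one_le (h : KernelBound V k q) {x : ℝ} (hx : 0 ≤ x) :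
    ‖jostFactor V k x - 1‖ ≤ Real.exp (tail q x) - 1 := by
  have hE := integral_Ioi_mul_exp_tail h.integrable one_ne_zero hx
  simp only [one_mul, div_one] at hE
  have hb := h.norm_volterra_le hx hE.1 fun t ht => h.norm_jostFactor_le ht
  rw [hE.2] at hb
  rw [h.jostFactor_eq hx, add_sub_cancel_left]
  exact hb

theorem KernelBound.tendsto_jostFactor (h : KernelBound V k q) :
    Tendsto (jostFactor V k) atTop (𝓝 1) := by
  rw [tendsto_iff_norm_sub_tendsto_zero]
  have h1 : Tendsto (fun x => Real.exp (tail q x) - 1) atTop (𝓝 0) := by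
    have := ((Real.continuous_exp.tendsto 0).comp (tendsto_tail_atTop h.integrable)).sub_const 1
    simpa using this
  refine squeeze_zero' (Eventually.of_forall fun _ => norm_nonneg _) ?_ h1
  filter_upwards [eventually_ge_atTop 0] with x hx using h.norm_jostFactor_sub_one_le hx

/-- One q for all k in U supplies the common integrable bound that holomorphy under the integral
requires. -/
theorem differentiableOn_jostIter {U : Set ℂ} (hU : IsOpen U)
    (h : ∀ k ∈ U, KernelBound V k q) (n : ℕ) :
    ∀ x, 0 ≤ x → DifferentiableOn ℂ (fun k => jostIter V k n x) U := by
  rcases U.eq_empty_or_nonempty with rfl | ⟨k₁, hk₁⟩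
  · intro x _; exact differentiableOn_empty
  induction n with
  | zero => intro x _; exact differentiableOn_const _
  | succ n ih =>
    intro x hx
    refine (differentiableOn_const 1).add ?_
    refine differentiableOn_integral_of_norm_le hU (g := fun t => q t * Real.exp (tail q 0))
      (fun k hk => (h k hk).aestronglyMeasurable x ((h k hk).aestronglyMeasurable_jostIter n))
      ?_ ?_ ((h k₁ hk₁).integrable.mul_const _)
    · filter_upwards [ae_restrict_mem measurableSet_Ioi] with t ht
      exact ((differentiable_volterraKernel _).differentiableOn.mul_const _).mul
        (ih t (le_of_lt ht))
    · filter_upwards [ae_restrict_mem measurableSet_Ioi] with t ht k hk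
      rw [norm_mul]
      exact mul_le_mul ((h k hk).norm_kernel_le' hx ht)
        ((h k hk).norm_jostIter_le_const n (le_of_lt ht)) (norm_nonneg _) ((h k hk).nonneg t ht)

theorem differentiableOn_jostFactor {U : Set ℂ} (hU : IsOpen U)
    (h : ∀ k ∈ U, KernelBound V k q) {x : ℝ} (hx : 0 ≤ x) :
    DifferentiableOn ℂ (fun k => jostFactor V k x) U := by
  have hu : TendstoUniformlyOn (fun n k => jostIter V k n x) (fun k => jostFactor V k x)
      atTop U := by
    rw [Metric.tendstoUniformlyOn_iff]
    intro ε hε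
    have ht : Tendsto (fun n : ℕ => 2 * Real.exp (2 * tail q 0) * (1 / 2 : ℝ) ^ n) atTop (𝓝 0) := by
      simpa using (tendsto_pow_atTop_nhds_zero_of_lt_one (by norm_num : (0 : ℝ) ≤ 1 / 2)
        (by norm_num)).const_mul (2 * Real.exp (2 * tail q 0))
    filter_upwards [ht.eventually (gt_mem_nhds hε)] with n hn k hk
    rw [dist_comm]
    exact ((h k hk).dist_jostIter_le hx n).trans_lt hn
  exact hu.tendstoLocallyUniformlyOn.differentiableOn
    (Eventually.of_forall fun n => differentiableOn_jostIter hU h n x hx) hU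

end Jost

/-! ### Uniqueness for the differential equation and Wronskians -/

/-- The backward counterpart of `eq_zero_of_le_integral`. -/
theorem eq_zero_of_le_integral_right {q N : ℝ → ℝ} {X : ℝ} (hX : 0 ≤ X)
    (hq : ∀ x, 0 ≤ x → IntervalIntegrable q volume 0 x) (hq0 : ∀ x, 0 ≤ q x)
    (hN : ContinuousOn N (Icc 0 X)) (hN0 : ∀ x ∈ Icc 0 X, 0 ≤ N x)
    (h : ∀ x ∈ Icc 0 X, N x ≤ ∫ t in x..X, q t * N t) : ∀ x ∈ Icc 0 X, N x = 0 := by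
  -- The weight now decreases, so that ∫ from y to X of q e^Q is (e^{Q y} - e^{Q X})/2, again at
  -- most half of e^{Q y}.
  let Q : ℝ → ℝ := fun x => ∫ t in (0 : ℝ)..x, -2 * q t
  have hQ : IsPrimitive Q (fun t => -2 * q t) :=
    ⟨fun x hx => (hq x hx).const_mul _, fun x _ => by simp [Q]⟩
  have hE := hQ.rexp
  have hQc : ContinuousOn Q (Icc 0 X) := hQ.continuousOn.mono Icc_subset_Ici_self
  obtain ⟨y, hy, hmax⟩ := isCompact_Icc.exists_isMaxOn (nonempty_Icc.2 hX)
    (hN.mul (hQc.neg.rexp))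
  have hmax' : ∀ x ∈ Icc 0 X, N x * Real.exp (-Q x) ≤ N y * Real.exp (-Q y) := fun x hx => hmax hx
  set M := N y * Real.exp (-Q y) with hM
  have hle : ∀ x ∈ Icc 0 X, N x ≤ M * Real.exp (Q x) := by
    intro x hx
    have := mul_le_mul_of_nonneg_right (hmax' x hx) (Real.exp_pos (Q x)).le
    rwa [mul_assoc, ← Real.exp_add, neg_add_cancel, Real.exp_zero, mul_one] at this
  have hM0 : 0 ≤ M := mul_nonneg (hN0 y hy) (Real.exp_pos _).le
  have hsub : uIcc y X ⊆ Icc 0 X := by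
    rw [uIcc_of_le hy.2]; exact Icc_subset_Icc_left hy.1
  have hint : ∫ t in y..X, q t * N t ≤ ∫ t in y..X,
      -(M / 2) * (Real.exp (Q t) * (-2 * q t)) := by
    refine intervalIntegral.integral_mono_on hy.2
      (((hq y hy.1).symm.trans (hq X hX)).mul_continuousOn (hN.mono hsub))
      ((hE.intervalIntegrable hy.1 hX).const_mul _) fun t ht => ?_
    have := mul_le_mul_of_nonneg_left (hle t (hsub (by rwa [uIcc_of_le hy.2]))) (hq0 t)
    linarith
  rw [intervalIntegral.integral_const_mul, ← hE.sub_eq_integral hy.1 hX] at hint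
  have hNy : N y = M * Real.exp (Q y) := by
    rw [hM, mul_assoc, ← Real.exp_add, neg_add_cancel, Real.exp_zero, mul_one]
  have hfin := (h y hy).trans hint
  rw [hNy] at hfin
  have hMz : M = 0 := by
    have h1 := Real.exp_pos (Q y)
    have h2 := Real.exp_pos (Q X)
    nlinarith [mul_nonneg hM0 h1.le, mul_nonneg hM0 h2.le]
  intro x hx
  exact le_antisymm (by simpa [hMz] using hle x hx) (hN0 x hx)

/-- `-y'' + V y = f` on `[0, ∞)` with `y' = p`. -/
structure SolvesWith (V f y p : ℝ → ℂ) : Prop where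
  hasDeriv : ∀ x, 0 ≤ x → HasDerivWithinAt y (p x) (Ici 0) x
  primitive : IsPrimitive p fun t => V t * y t - f t

theorem solves_iff {V f y : ℝ → ℂ} : Solves V f y ↔ ∃ p, SolvesWith V f y p :=
  ⟨fun ⟨p, h1, h2, h3⟩ => ⟨p, h1, h2, h3⟩, fun ⟨p, h1, h2⟩ => ⟨p, h1, h2.1, h2.2⟩⟩

section SolvesWith

variable {V f g y z p r : ℝ → ℂ}

theorem SolvesWith.isPrimitive (h : SolvesWith V f y p) : IsPrimitive y p :=
  isPrimitive_of_hasDerivWithinAt h.hasDeriv h.primitive.continuousOn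

theorem SolvesWith.continuousOn (h : SolvesWith V f y p) : ContinuousOn y (Ici 0) :=
  h.isPrimitive.continuousOn

theorem SolvesWith.sub (h : SolvesWith V f y p) (h' : SolvesWith V g z r) :
    SolvesWith V (fun x => f x - g x) (fun x => y x - z x) (fun x => p x - r x) :=
  ⟨fun x hx => (h.hasDeriv x hx).sub (h'.hasDeriv x hx),
    (h.primitive.sub h'.primitive).congr_right fun x _ => by ring⟩

theorem SolvesWith.const_mul (h : SolvesWith V f y p) (c : ℂ) :
    SolvesWith V (fun x => c * f x) (fun x => c * y x) (fun x => c * p x) :=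
  ⟨fun x hx => (h.hasDeriv x hx).const_mul c,
    (h.primitive.const_mul c).congr_right fun x _ => by ring⟩

theorem SolvesWith.congr (h : SolvesWith V f y p) (hfg : ∀ x, 0 < x → f x = g x) :
    SolvesWith V g y p :=
  ⟨h.hasDeriv, h.primitive.congr_right fun x hx => by rw [hfg x hx]⟩

/-- The derivative of the Wronskian. -/
theorem SolvesWith.wronskian (h : SolvesWith V f y p) (h' : SolvesWith V g z r) :
    IsPrimitive (fun x => y x * r x - p x * z x) (fun x => f x * z x - y x * g x) :=
  ((h.isPrimitive.mul h'.primitive).sub (h.primitive.mul h'.isPrimitive)).congr_right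
    fun x _ => by ring

/-- The equation is read as the first-order system y' = p, p' = (V - κ) y. This is the integral
inequality to which the two vanishing lemmas apply, forwards from 0 and backwards from X. -/
theorem SolvesWith.norm_bound {κ : ℂ} (hV : ∀ x, 0 ≤ x → IntervalIntegrable V volume 0 x)
    (h : SolvesWith V (fun x => κ * y x) y p) {a b : ℝ} (ha : 0 ≤ a) (hab : a ≤ b) :
    ‖y b - y a‖ + ‖p b - p a‖ ≤ ∫ t in a..b, (1 + ‖V t‖ + ‖κ‖) * (‖y t‖ + ‖p t‖) := by
  have hb : 0 ≤ b := ha.trans hab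
  have hs : uIcc a b ⊆ Ici 0 := by
    rw [uIcc_of_le hab]; exact fun t ht => ha.trans ht.1
  have hyc := h.continuousOn.mono hs
  have hpc := h.primitive.continuousOn.mono hs
  have hVi : IntervalIntegrable V volume a b := (hV a ha).symm.trans (hV b hb)
  have hq : IntervalIntegrable (fun t => 1 + ‖V t‖ + ‖κ‖) volume a b :=
    ((intervalIntegrable_const (c := (1 : ℝ))).add hVi.norm).add intervalIntegrable_const
  rw [h.isPrimitive.sub_eq_integral ha hb, h.primitive.sub_eq_integral ha hb]
  refine (add_le_add (intervalIntegral.norm_integral_le_integral_norm hab)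
    (intervalIntegral.norm_integral_le_integral_norm hab)).trans ?_
  rw [← intervalIntegral.integral_add hpc.norm.intervalIntegrable
    (h.primitive.intervalIntegrable ha hb).norm]
  refine intervalIntegral.integral_mono_on hab
    (hpc.norm.intervalIntegrable.add (h.primitive.intervalIntegrable ha hb).norm)
    (hq.mul_continuousOn (hyc.norm.add hpc.norm)) fun t _ => ?_
  have h1 : ‖V t * y t - κ * y t‖ ≤ ‖V t‖ * ‖y t‖ + ‖κ‖ * ‖y t‖ := by
    refine (norm_sub_le _ _).trans ?_
    rw [norm_mul, norm_mul]
  have h2 := norm_nonneg (V t)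
  have h3 := norm_nonneg (p t)
  have h4 := norm_nonneg (y t)
  have h5 := norm_nonneg κ
  nlinarith [mul_nonneg h2 h3, mul_nonneg h5 h3]

/-- Uniqueness for the initial value problem at `0`. -/
theorem SolvesWith.eq_zero_of_initial {κ : ℂ}
    (hV : ∀ x, 0 ≤ x → IntervalIntegrable V volume 0 x)
    (h : SolvesWith V (fun x => κ * y x) y p) (hy : y 0 = 0) (hp : p 0 = 0) :
    ∀ x, 0 ≤ x → y x = 0 := by
  intro x hx
  have := eq_zero_of_le_integral (q := fun t => 1 + ‖V t‖ + ‖κ‖) (N := fun t => ‖y t‖ + ‖p t‖) hx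
    (fun x hx => ((intervalIntegrable_const (c := (1 : ℝ))).add (hV x hx).norm).add
      intervalIntegrable_const) (fun t => by positivity)
    ((h.continuousOn.norm.add h.primitive.continuousOn.norm).mono Icc_subset_Ici_self)
    (fun t _ => by positivity)
    (fun t ht => by simpa [hy, hp] using h.norm_bound hV le_rfl ht.1) x ⟨hx, le_rfl⟩
  have h1 := norm_nonneg (y x)
  have h2 := norm_nonneg (p x)
  exact norm_eq_zero.1 (by linarith)

/-- Uniqueness, to the left, for the initial value problem at `X`. -/
theorem SolvesWith.eq_zero_of_terminal {κ : ℂ}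
    (hV : ∀ x, 0 ≤ x → IntervalIntegrable V volume 0 x)
    (h : SolvesWith V (fun x => κ * y x) y p) {X : ℝ} (hX : 0 ≤ X) (hy : y X = 0) (hp : p X = 0) :
    ∀ x ∈ Icc 0 X, y x = 0 := by
  intro x hx
  have := eq_zero_of_le_integral_right (q := fun t => 1 + ‖V t‖ + ‖κ‖)
    (N := fun t => ‖y t‖ + ‖p t‖) hX
    (fun x hx => ((intervalIntegrable_const (c := (1 : ℝ))).add (hV x hx).norm).add
      intervalIntegrable_const) (fun t => by positivity)
    ((h.continuousOn.norm.add h.primitive.continuousOn.norm).mono Icc_subset_Ici_self)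
    (fun t _ => by positivity)
    (fun t ht => by simpa [hy, hp] using h.norm_bound hV ht.1 ht.2) x hx
  have h1 := norm_nonneg (y x)
  have h2 := norm_nonneg (p x)
  exact norm_eq_zero.1 (by linarith)

end SolvesWith

/-- If the Wronskian of `e ~ e^{ikx}`, `Im k ≥ 0`, and `u` has a limit at infinity and `u` is
small at arbitrarily large pairs of points at any given distance, then the limit is zero. -/
theorem wronskian_limit_eq_zero {k : ℂ} (hk : 0 ≤ k.im) {e p u r : ℝ → ℂ} {L : ℂ}
    (he : ∀ x, 0 < x → HasDerivAt e (p x) x)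
    (hasy : Tendsto (fun x : ℝ => e x * Complex.exp (-(Complex.I * k * x))) atTop (𝓝 1))
    (hu : ∀ x, 0 < x → HasDerivAt u (r x) x)
    (hW : Tendsto (fun x => e x * r x - p x * u x) atTop (𝓝 L))
    (hsmall : ∀ h > 0, ∀ ε > 0, ∃ᶠ x in atTop, ‖u x‖ < ε ∧ ‖u (x + h)‖ < ε) : L = 0 := by
  set m : ℝ → ℂ := fun x => e x * Complex.exp (-(Complex.I * k * x)) with hm
  have hem : ∀ x, e x = m x * Complex.exp (Complex.I * k * x) := fun x => by
    rw [hm]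
    simp only
    rw [mul_assoc, ← Complex.exp_add, neg_add_cancel, Complex.exp_zero, mul_one]
  -- The quotient u/e has derivative W/e², so e^{2ikx} times its increment over [x, x + h] is close
  -- to L ∫₀ʰ e^{-2iks} ds for large x. A step h is chosen for which this integral is nonzero; its
  -- derivative at h = 0 is 1.
  obtain ⟨h, hh0, hDh⟩ : ∃ h : ℝ, 0 < h ∧ volterraKernel (-k) h ≠ 0 := by
    have h1 := (hasDerivAt_volterraKernel (-k) 0).eventually_ne (c := 0) (by simp)
    have h2 : ∀ᶠ s in 𝓝[>] (0 : ℝ), volterraKernel (-k) s ≠ 0 :=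
      h1.filter_mono (nhdsWithin_mono _ fun s hs => ne_of_gt hs)
    obtain ⟨s, hs1, hs2⟩ := (h2.and self_mem_nhdsWithin).exists
    exact ⟨s, hs2, hs1⟩
  have hφ : Tendsto (fun x => (e x * r x - p x * u x) / m x ^ 2) atTop (𝓝 L) := by
    have h1 := hW.div (hasy.pow 2) (by simp)
    rwa [one_pow, div_one] at h1
  by_contra hL
  set B := Real.exp (2 * k.im * h) with hB
  have hB1 : 1 ≤ B := Real.one_le_exp (by positivity)
  set δ := ‖L * volterraKernel (-k) h‖ with hδ
  have hδ0 : 0 < δ := norm_pos_iff.2 (mul_ne_zero hL hDh)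
  -- The constants make the mean value error δ/4 and each of the two endpoint terms at most δ/8,
  -- which together stay below δ.
  set ε₁ := δ / (4 * (B * h)) with hε₁
  have hε₁0 : 0 < ε₁ := by positivity
  set ε₂ := δ / (16 * B) with hε₂
  have hε₂0 : 0 < ε₂ := by positivity
  have hev : ∀ᶠ x in atTop, (1 / 2 < ‖m x‖ ∧ 0 < x) ∧
      ‖(e x * r x - p x * u x) / m x ^ 2 - L‖ < ε₁ := by
    refine ((hasy.norm.eventually (lt_mem_nhds (by norm_num))).and (eventually_gt_atTop 0)).and ?_
    exact (tendsto_iff_norm_sub_tendsto_zero.1 hφ).eventually (gt_mem_nhds hε₁0)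
  obtain ⟨X, hX⟩ := eventually_atTop.1 hev
  obtain ⟨x, ⟨hu1, hu2⟩, hxX⟩ :=
    ((hsmall h hh0 ε₂ hε₂0).and_eventually (eventually_ge_atTop X)).exists
  have hm0 : ∀ t, X ≤ t → m t ≠ 0 := fun t ht => by
    have := (hX t ht).1.1
    exact norm_pos_iff.1 (by linarith)
  have hderiv : ∀ s ∈ Icc 0 h, HasDerivWithinAt
      (fun s => Complex.exp (2 * Complex.I * k * x) * (u (x + s) / e (x + s)) -
        L * volterraKernel (-k) s)
      (((e (x + s) * r (x + s) - p (x + s) * u (x + s)) / m (x + s) ^ 2 - L) *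
        Complex.exp (2 * Complex.I * (-k) * s)) (Icc 0 h) s := by
    intro s hs
    have hxs : X ≤ x + s := by linarith [hs.1]
    have hpos := (hX _ hxs).1.2
    have hexp := Complex.exp_ne_zero (Complex.I * k * ((x + s : ℝ) : ℂ))
    have he0 : e (x + s) ≠ 0 := by
      rw [hem]; exact mul_ne_zero (hm0 _ hxs) hexp
    have d1 := ((hu _ hpos).comp_const_add x s).div ((he _ hpos).comp_const_add x s) he0
    have d2 := (d1.const_mul (Complex.exp (2 * Complex.I * k * x))).sub
      ((hasDerivAt_volterraKernel (-k) s).const_mul L)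
    refine (d2.hasDerivWithinAt).congr_deriv ?_
    rw [sub_mul]
    congr 1
    have hE : Complex.exp (2 * Complex.I * k * x) = Complex.exp (2 * Complex.I * (-k) * s) *
        Complex.exp (Complex.I * k * ((x + s : ℝ) : ℂ)) ^ 2 := by
      rw [← Complex.exp_nat_mul, ← Complex.exp_add]
      congr 1
      push_cast
      ring
    have hmx := hm0 _ hxs
    have hem2 : e (x + s) ^ 2 =
        m (x + s) ^ 2 * Complex.exp (Complex.I * k * ((x + s : ℝ) : ℂ)) ^ 2 := by
      rw [hem, mul_pow]
    rw [hE, hem2]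
    field_simp
  have hmv := (convex_Icc 0 h).norm_image_sub_le_of_norm_hasDerivWithin_le (C := ε₁ * B) hderiv
    (fun s hs => by
      rw [norm_mul, norm_cexp_two_I_mul]
      refine mul_le_mul (hX _ (by linarith [hs.1])).2.le ?_ (Real.exp_pos _).le hε₁0.le
      refine Real.exp_le_exp.2 ?_
      rw [Complex.neg_im]
      nlinarith [mul_le_mul_of_nonneg_left hs.2 hk])
    (left_mem_Icc.2 hh0.le) (right_mem_Icc.2 hh0.le)
  simp only [add_zero, volterraKernel_zero_right, mul_zero, sub_zero] at hmv
  -- The factor e^{2ikx}/e(x+s) has modulus e^{Im k (s - x)}/|m(x+s)|, which is at most 2B; hence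
  -- smallness of u alone suffices.
  have hterm : ∀ s, 0 ≤ s → s ≤ h → ‖u (x + s)‖ < ε₂ →
      ‖Complex.exp (2 * Complex.I * k * x) * (u (x + s) / e (x + s))‖ ≤ 2 * B * ε₂ := by
    intro s hs0 hsh hus
    have hxs : X ≤ x + s := by linarith
    have hmx := (hX _ hxs).1.1
    have hx0 := (hX x hxX).1.2
    rw [norm_mul, norm_cexp_two_I_mul, norm_div, hem, norm_mul, Complex.norm_exp]
    have hre : (Complex.I * k * ((x + s : ℝ) : ℂ)).re = -(k.im * (x + s)) := by simp
    rw [hre]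
    have e1 : Real.exp (-2 * k.im * x) * (‖u (x + s)‖ / (‖m (x + s)‖ *
        Real.exp (-(k.im * (x + s))))) =
        Real.exp (k.im * (s - x)) * (‖u (x + s)‖ / ‖m (x + s)‖) := by
      have : Real.exp (-2 * k.im * x) =
          Real.exp (k.im * (s - x)) * Real.exp (-(k.im * (x + s))) := by
        rw [← Real.exp_add]; congr 1; ring
      rw [this]
      have := (Real.exp_pos (-(k.im * (x + s)))).ne'
      field_simp
    rw [e1]
    have e2 : Real.exp (k.im * (s - x)) ≤ B :=
      Real.exp_le_exp.2 (by nlinarith [mul_nonneg hk hx0.le, mul_nonneg hk hs0,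
        mul_le_mul_of_nonneg_left hsh hk])
    have e3 : ‖u (x + s)‖ / ‖m (x + s)‖ ≤ 2 * ε₂ := by
      rw [div_le_iff₀ (by linarith)]
      nlinarith
    calc _ ≤ B * (2 * ε₂) := mul_le_mul e2 e3 (by positivity) (by positivity)
      _ = _ := by ring
  have t0 := hterm 0 le_rfl hh0.le (by simpa using hu1)
  have th := hterm h hh0.le le_rfl hu2
  rw [add_zero] at t0
  set α := Complex.exp (2 * Complex.I * k * x) * (u (x + h) / e (x + h))
  set γ := Complex.exp (2 * Complex.I * k * x) * (u x / e x)
  have hfin : δ ≤ ‖α - L * volterraKernel (-k) h - γ‖ + ‖α‖ + ‖γ‖ := by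
    have : L * volterraKernel (-k) h = -(α - L * volterraKernel (-k) h - γ) + α - γ := by ring
    rw [hδ, this]
    refine (norm_sub_le _ _).trans (add_le_add_left ((norm_add_le _ _).trans ?_) _)
    rw [norm_neg, ← this]
  have h1 : ε₁ * B * ‖h‖ = δ / 4 := by
    rw [Real.norm_of_nonneg hh0.le, hε₁]; field_simp
  have h2 : 2 * B * ε₂ = δ / 8 := by rw [hε₂]; field_simp; norm_num
  rw [h1] at hmv
  rw [h2] at t0 th
  linarith

/-- A solution whose Wronskian with a Jost solution vanishes is a multiple of it. -/
theorem exists_eq_const_mul_of_wronskian {V : ℝ → ℂ}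
    (hV : ∀ x, 0 ≤ x → IntervalIntegrable V volume 0 x) {k : ℂ} {e p u r : ℝ → ℂ}
    (he : SolvesWith V (fun x => k ^ 2 * e x) e p)
    (hasy : Tendsto (fun x : ℝ => e x * Complex.exp (-(Complex.I * k * x))) atTop (𝓝 1))
    (hu : SolvesWith V (fun x => k ^ 2 * u x) u r)
    (hW : ∀ x, 0 ≤ x → e x * r x - p x * u x = 0) :
    ∃ c, ∀ x, 0 ≤ x → u x = c * e x := by
  obtain ⟨X, hX⟩ := eventually_atTop.1 ((hasy.eventually_ne one_ne_zero).and
    (eventually_ge_atTop 0))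
  have he0 : ∀ x, X ≤ x → e x ≠ 0 := fun x hx h0 => (hX x hx).1 (by rw [h0, zero_mul])
  -- The multiple of e that agrees with u at Y also has the same derivative there, because the
  -- Wronskian vanishes and e Y ≠ 0. Comparing two values at X shows that the multiple does not
  -- depend on Y.
  have key : ∀ Y, X ≤ Y → ∀ x ∈ Icc 0 Y, u x = u Y / e Y * e x := by
    intro Y hY x hx
    have hY0 := (hX Y hY).2
    have hs := (hu.sub (he.const_mul (u Y / e Y))).congr
      (g := fun x => k ^ 2 * (u x - u Y / e Y * e x)) fun t _ => by ring
    have := hs.eq_zero_of_terminal hV hY0 (by field_simp [he0 Y hY]; ring) (by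
      have h1 := hW Y hY0
      have h2 := he0 Y hY
      field_simp
      linear_combination h1) x hx
    exact sub_eq_zero.1 this
  refine ⟨u X / e X, fun x hx => ?_⟩
  have hX0 := (hX X le_rfl).2
  have h1 := key (max x X) (le_max_right _ _) x ⟨hx, le_max_left _ _⟩
  have h2 := key (max x X) (le_max_right _ _) X ⟨hX0, le_max_right _ _⟩
  rw [h1, h2, mul_div_assoc, div_self (he0 X le_rfl), mul_one]

/-! ### Kernel bounds for an exponentially decaying potential -/

section Potential

variable {V : ℝ → ℂ} {a : ℝ}

theorem aestronglyMeasurable_potential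
    (hV : IntegrableOn (fun x : ℝ => Real.exp (a * x) • V x) (Ioi 0)) :
    AEStronglyMeasurable V (volume.restrict (Ioi 0)) := by
  have h1 : AEStronglyMeasurable (fun x : ℝ => Real.exp (-(a * x)) • (Real.exp (a * x) • V x))
      (volume.restrict (Ioi 0)) :=
    AEStronglyMeasurable.smul
      (by fun_prop : Continuous fun x : ℝ => Real.exp (-(a * x))).aestronglyMeasurable
      hV.aestronglyMeasurable
  refine h1.congr (Eventually.of_forall fun x => ?_)
  simp only [smul_smul, ← Real.exp_add]
  simp

theorem integrableOn_mul_norm_potential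
    (hV : IntegrableOn (fun x : ℝ => Real.exp (a * x) • V x) (Ioi 0)) {g : ℝ → ℝ} {C : ℝ}
    (hg : AEStronglyMeasurable g (volume.restrict (Ioi 0)))
    (hC : ∀ t, 0 < t → ‖g t‖ ≤ C * Real.exp (a * t)) :
    IntegrableOn (fun t => g t * ‖V t‖) (Ioi 0) := by
  refine (hV.norm.const_mul C).mono' (hg.mul (aestronglyMeasurable_potential hV).norm) ?_
  filter_upwards [ae_restrict_mem measurableSet_Ioi] with t ht
  rw [norm_mul, norm_norm, norm_smul, Real.norm_of_nonneg (Real.exp_pos _).le, ← mul_assoc]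
  exact mul_le_mul_of_nonneg_right (hC t ht) (norm_nonneg _)

theorem integrableOn_potential (ha : 0 < a)
    (hV : IntegrableOn (fun x : ℝ => Real.exp (a * x) • V x) (Ioi 0)) : IntegrableOn V (Ioi 0) := by
  have h1 := integrableOn_mul_norm_potential hV (g := fun _ => 1) (C := 1)
    aestronglyMeasurable_const fun t ht => by
      simpa using mul_nonneg ha.le ht.le
  simp only [one_mul] at h1
  exact (integrable_norm_iff (aestronglyMeasurable_potential hV)).1 h1

theorem intervalIntegrable_potential (ha : 0 < a)
    (hV : IntegrableOn (fun x : ℝ => Real.exp (a * x) • V x) (Ioi 0)) (x : ℝ) (hx : 0 ≤ x) :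
    IntervalIntegrable V volume 0 x :=
  (intervalIntegrable_iff_integrableOn_Ioc_of_le hx).2
    ((integrableOn_potential ha hV).mono_set Ioc_subset_Ioi_self)

/-- The strict margin a - 2b absorbs the factor t, which is why the disc radius must first stay
below A + a/2. -/
theorem mul_exp_le {b : ℝ} (hba : 2 * b < a) (t : ℝ) :
    t * Real.exp (2 * b * t) ≤ 1 / (a - 2 * b) * Real.exp (a * t) := by
  have h0 : 0 < a - 2 * b := by linarith
  have h1 : (a - 2 * b) * t ≤ Real.exp ((a - 2 * b) * t) := by
    linarith [Real.add_one_le_exp ((a - 2 * b) * t)]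
  have h2 : Real.exp (a * t) = Real.exp ((a - 2 * b) * t) * Real.exp (2 * b * t) := by
    rw [← Real.exp_add]; congr 1; ring
  rw [h2, ← mul_assoc]
  refine mul_le_mul_of_nonneg_right ?_ (Real.exp_pos _).le
  rw [one_div, le_inv_mul_iff₀ h0]
  exact h1

theorem rpow_le_one_add {t β : ℝ} (ht : 0 ≤ t) (hβ : β ∈ Ico (0 : ℝ) 1) : t ^ β ≤ 1 + t := by
  rcases le_total t 1 with h | h
  · linarith [Real.rpow_le_one ht h hβ.1]
  · have := Real.rpow_le_rpow_of_exponent_le h hβ.2.le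
    rw [Real.rpow_one] at this
    linarith

/-- The kernel bound that is uniform on the half-plane `Im k ≥ -b`. -/
theorem kernelBound_mul_exp (hV : IntegrableOn (fun x : ℝ => Real.exp (a * x) • V x) (Ioi 0))
    {b : ℝ} (hb : 0 ≤ b) (hba : 2 * b < a) {k : ℂ} (hk : -b ≤ k.im) :
    KernelBound V k fun t => t * Real.exp (2 * b * t) * ‖V t‖ where
  integrable := integrableOn_mul_norm_potential hV (C := 1 / (a - 2 * b))
    (Continuous.aestronglyMeasurable (by fun_prop)) fun t ht => by
      rw [Real.norm_of_nonneg (by positivity)]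
      exact mul_exp_le hba t
  meas := aestronglyMeasurable_potential hV
  nonneg t ht := by positivity
  le x t hx hxt ht := by
    rw [norm_mul]
    refine mul_le_mul_of_nonneg_right ?_ (norm_nonneg _)
    refine (norm_volterraKernel_le_mul_exp hb hk (by linarith)).trans ?_
    gcongr <;> linarith

/-- The kernel bound for `Im k ≥ -b` and `|k| ≥ c`. -/
theorem kernelBound_rpow (hV : IntegrableOn (fun x : ℝ => Real.exp (a * x) • V x) (Ioi 0))
    {b : ℝ} (hb : 0 ≤ b) (hba : 2 * b < a) {k : ℂ} (hk : -b ≤ k.im) {c β : ℝ} (hc : 0 < c)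
    (hkc : c ≤ ‖k‖) (hβ : β ∈ Ico (0 : ℝ) 1) :
    KernelBound V k fun t =>
      1 / (2 * c) ^ (1 - β) * (t ^ β * (1 + Real.exp (2 * b * t)) * ‖V t‖) where
  integrable := by
    refine Integrable.const_mul (integrableOn_mul_norm_potential hV
      (g := fun t => t ^ β * (1 + Real.exp (2 * b * t))) (C := 2 * (1 + 1 / (a - 2 * b))) ?_
      fun t ht => ?_) _
    · exact ((continuous_id.rpow_const fun _ => Or.inr hβ.1).mul
        (by fun_prop)).aestronglyMeasurable
    · have h1 := rpow_le_one_add ht.le hβ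
      have h2 := mul_exp_le hba t
      have h3 : 1 ≤ Real.exp (2 * b * t) := Real.one_le_exp (by positivity)
      have h4 : Real.exp (2 * b * t) ≤ Real.exp (a * t) :=
        Real.exp_le_exp.2 (mul_le_mul_of_nonneg_right hba.le ht.le)
      rw [Real.norm_of_nonneg (by positivity)]
      calc t ^ β * (1 + Real.exp (2 * b * t))
          ≤ (1 + t) * (2 * Real.exp (2 * b * t)) :=
            mul_le_mul h1 (by linarith) (by positivity) (by positivity)
        _ = 2 * (Real.exp (2 * b * t) + t * Real.exp (2 * b * t)) := by ring
        _ ≤ 2 * (Real.exp (a * t) + 1 / (a - 2 * b) * Real.exp (a * t)) := by linarith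
        _ = _ := by ring
  meas := aestronglyMeasurable_potential hV
  nonneg t ht := by positivity
  le x t hx hxt ht := by
    rw [norm_mul, ← mul_assoc]
    refine mul_le_mul_of_nonneg_right ?_ (norm_nonneg _)
    refine (norm_volterraKernel_le_rpow hb hk (by linarith) hc hkc hβ).trans ?_
    have h1 : (t - x) ^ β ≤ t ^ β :=
      Real.rpow_le_rpow (by linarith) (by linarith) hβ.1
    have h2 : Real.exp (2 * b * (t - x)) ≤ Real.exp (2 * b * t) :=
      Real.exp_le_exp.2 (mul_le_mul_of_nonneg_left (by linarith) (by linarith))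
    have h3 : 0 ≤ (t - x) ^ β := Real.rpow_nonneg (by linarith) _
    gcongr

end Potential

/-! ### The Jost solution -/

/-- The Jost solution obtained from the Volterra equation. -/
def jostSol (V : ℝ → ℂ) (k : ℂ) (x : ℝ) : ℂ :=
  Complex.exp (Complex.I * k * x) * jostFactor V k x

/-- `∫ₓ^∞ e^{2ikt} V(t) m(t, k) dt`. -/
def jostTail (V : ℝ → ℂ) (k : ℂ) (x : ℝ) : ℂ :=
  ∫ t in Ioi x, Complex.exp (2 * Complex.I * k * t) * (V t * jostFactor V k t)

/-- The derivative of `jostSol`. -/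
def jostSolDeriv (V : ℝ → ℂ) (k : ℂ) (x : ℝ) : ℂ :=
  Complex.I * k * jostSol V k x - Complex.exp (-(Complex.I * k * x)) * jostTail V k x

/-- The kernel has derivative of modulus at most 1 when Im k ≥ 0. The Lipschitz bound survives
truncation, so the integral can be differentiated in x despite the corner at t = x. -/
theorem volterraKernel_lipschitz {k : ℂ} (hk : 0 ≤ k.im) {s t : ℝ} (hs : 0 ≤ s) (ht : 0 ≤ t) :
    ‖volterraKernel k t - volterraKernel k s‖ ≤ |t - s| := by
  have := (convex_Ici (0 : ℝ)).norm_image_sub_le_of_norm_hasDerivWithin_le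
    (f := volterraKernel k) (C := 1)
    (fun u _ => (hasDerivAt_volterraKernel k u).hasDerivWithinAt)
    (fun u hu => by
      have := norm_cexp_two_I_mul_le (b := 0) le_rfl (by simpa using hk) (mem_Ici.1 hu) le_rfl
      simpa using this) hs ht
  simpa using this

section JostSol

variable {V : ℝ → ℂ} {a : ℝ} {k : ℂ}

theorem integrableOn_exp_mul_jostFactor (ha : 0 < a)
    (hV : IntegrableOn (fun x : ℝ => Real.exp (a * x) • V x) (Ioi 0)) (hk : 0 ≤ k.im) :
    IntegrableOn (fun t : ℝ => Complex.exp (2 * Complex.I * k * t) * (V t * jostFactor V k t))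
      (Ioi 0) := by
  have hB := kernelBound_mul_exp hV (b := 0) le_rfl (by linarith) (by simpa using hk)
  have h1 := (integrableOn_potential ha hV).mul_bdd hB.aestronglyMeasurable_jostFactor
    ((ae_restrict_mem measurableSet_Ioi).mono fun t ht =>
      hB.norm_jostFactor_le_const (le_of_lt ht))
  refine h1.bdd_mul (c := 1) (Continuous.aestronglyMeasurable (by fun_prop)) ?_
  filter_upwards [ae_restrict_mem measurableSet_Ioi] with t ht
  simpa using norm_cexp_two_I_mul_le (b := 0) le_rfl (by simpa using hk) (le_of_lt ht) le_rfl

/-- Differentiation of the Volterra equation under the integral sign. No boundary term arises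
because the kernel vanishes at t = x, and the corner there is a null set. -/
theorem hasDerivWithinAt_jostFactor (ha : 0 < a)
    (hV : IntegrableOn (fun x : ℝ => Real.exp (a * x) • V x) (Ioi 0)) (hk : 0 ≤ k.im)
    {x : ℝ} (hx : 0 ≤ x) :
    HasDerivWithinAt (jostFactor V k)
      (-(Complex.exp (-(2 * Complex.I * k * x)) * jostTail V k x)) (Ici 0) x := by
  have hB := kernelBound_mul_exp hV (b := 0) le_rfl (by linarith) (by simpa using hk)
  have hVm : IntegrableOn (fun t => V t * jostFactor V k t) (Ioi 0) :=
    (integrableOn_potential ha hV).mul_bdd hB.aestronglyMeasurable_jostFactor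
      ((ae_restrict_mem measurableSet_Ioi).mono fun t ht =>
        hB.norm_jostFactor_le_const (le_of_lt ht))
  set F' : ℝ → ℂ := (Ioi x).indicator fun t =>
    -(Complex.exp (-(2 * Complex.I * k * x)) *
      (Complex.exp (2 * Complex.I * k * t) * (V t * jostFactor V k t))) with hF'
  have hIE := integrableOn_exp_mul_jostFactor ha hV hk
  have key := hasDerivAt_integral_of_dominated_loc_of_lip (μ := volume.restrict (Ioi 0))
    (F := fun x t => volterraKernel k (max (t - x) 0) * V t * jostFactor V k t) (F' := F')
    (x₀ := x) (s := univ) (bound := fun t => ‖V t * jostFactor V k t‖) univ_mem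
    (Eventually.of_forall fun y => hB.aestronglyMeasurable y hB.aestronglyMeasurable_jostFactor)
    (hB.integrable_of_bdd hx hB.aestronglyMeasurable_jostFactor
      fun t ht => hB.norm_jostFactor_le_const ht)
    (((hIE.aestronglyMeasurable.const_mul _).neg).indicator measurableSet_Ioi)
    (Eventually.of_forall fun t => ?_) hVm.norm ?_
  · have h1 : ∫ t in Ioi (0 : ℝ), F' t =
        -(Complex.exp (-(2 * Complex.I * k * x)) * jostTail V k x) := by
      rw [hF', setIntegral_indicator measurableSet_Ioi, inter_eq_right.2 (Ioi_subset_Ioi hx),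
        integral_neg, integral_const_mul, jostTail]
    rw [h1] at key
    have h2 := (key.2.const_add 1).hasDerivWithinAt (s := Ici 0)
    exact h2.congr (fun y hy => hB.jostFactor_eq hy) (hB.jostFactor_eq hx)
  · refine LipschitzOnWith.of_dist_le_mul fun y _ z _ => ?_
    rw [dist_eq_norm, mul_assoc, mul_assoc, ← sub_mul, norm_mul, mul_comm]
    refine mul_le_mul (by simp) ?_ (norm_nonneg _) NNReal.zero_le_coe
    refine (volterraKernel_lipschitz hk (le_max_right _ _) (le_max_right _ _)).trans ?_
    refine (abs_max_sub_max_le_abs _ _ _).trans ?_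
    rw [Real.dist_eq, abs_sub_comm]
    exact le_of_eq (congrArg _ (by ring))
  · have hne : ∀ᵐ t ∂(volume.restrict (Ioi (0 : ℝ))), t ≠ x :=
      ae_restrict_of_ae (by simp [ae_iff, measure_singleton])
    filter_upwards [hne] with t ht
    rcases lt_or_gt_of_ne ht with h | h
    · rw [hF', indicator_of_notMem (by simpa using h.le)]
      refine (hasDerivAt_const x (0 : ℂ)).congr_of_eventuallyEq ?_
      filter_upwards [lt_mem_nhds h] with y hy
      rw [max_eq_right (by linarith)]
      simp
    · rw [hF', indicator_of_mem (mem_Ioi.2 h)]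
      have h1 : HasDerivAt (fun y => volterraKernel k (t - y))
          (-(Complex.exp (2 * Complex.I * k * ((t - x : ℝ) : ℂ)))) x := by
        have := (hasDerivAt_volterraKernel k (t - x)).scomp x ((hasDerivAt_id x).const_sub t)
        simpa [Function.comp_def] using this
      have h2 := (h1.mul_const (V t)).mul_const (jostFactor V k t)
      have h3 : Complex.exp (2 * Complex.I * k * ((t - x : ℝ) : ℂ)) =
          Complex.exp (-(2 * Complex.I * k * x)) * Complex.exp (2 * Complex.I * k * t) := by
        rw [← Complex.exp_add]; congr 1; push_cast; ring
      rw [h3] at h2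
      refine (h2.congr_of_eventuallyEq ?_).congr_deriv (by ring)
      filter_upwards [gt_mem_nhds h] with y hy
      rw [max_eq_left (by linarith)]

theorem isPrimitive_jostTail (ha : 0 < a)
    (hV : IntegrableOn (fun x : ℝ => Real.exp (a * x) • V x) (Ioi 0)) (hk : 0 ≤ k.im) :
    IsPrimitive (jostTail V k)
      fun t => -(Complex.exp (2 * Complex.I * k * t) * (V t * jostFactor V k t)) := by
  have hI := integrableOn_exp_mul_jostFactor ha hV hk
  have hii : ∀ x, 0 ≤ x → IntervalIntegrable
      (fun t : ℝ => Complex.exp (2 * Complex.I * k * t) * (V t * jostFactor V k t)) volume 0 x :=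
    fun x hx => (intervalIntegrable_iff_integrableOn_Ioc_of_le hx).2
      (hI.mono_set Ioc_subset_Ioi_self)
  refine ⟨fun x hx => (hii x hx).neg, fun x hx => ?_⟩
  rw [intervalIntegral.integral_neg, jostTail, jostTail,
    ← intervalIntegral.integral_interval_add_Ioi hI (hI.mono_set (Ioi_subset_Ioi hx))]
  ring

theorem hasDerivAt_cexp_mul (c : ℂ) (x : ℝ) :
    HasDerivAt (fun x : ℝ => Complex.exp (c * x)) (c * Complex.exp (c * x)) x := by
  have h1 : HasDerivAt (fun s : ℝ => c * (s : ℂ)) c x := by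
    simpa using ((hasDerivAt_id x).ofReal_comp).const_mul c
  simpa [mul_comm] using h1.cexp

/-- With T = `jostTail`, e' = ik e - e^{-ikx} T and T' = -e^{2ikx} V m, so the terms in T cancel in
e'' and (V - k²) e remains. -/
theorem jostSol_solvesWith (ha : 0 < a)
    (hV : IntegrableOn (fun x : ℝ => Real.exp (a * x) • V x) (Ioi 0)) (hk : 0 ≤ k.im) :
    SolvesWith V (fun x => k ^ 2 * jostSol V k x) (jostSol V k) (jostSolDeriv V k) := by
  have hT := isPrimitive_jostTail ha hV hk
  have hd : ∀ x, 0 ≤ x → HasDerivWithinAt (jostSol V k) (jostSolDeriv V k x) (Ici 0) x := by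
    intro x hx
    have h1 := (hasDerivAt_cexp_mul (Complex.I * k) x).hasDerivWithinAt (s := Ici 0)
    refine (h1.mul (hasDerivWithinAt_jostFactor ha hV hk hx)).congr_deriv ?_
    have h2 : Complex.exp (-(Complex.I * k * x)) =
        Complex.exp (Complex.I * k * x) * Complex.exp (-(2 * Complex.I * k * x)) := by
      rw [← Complex.exp_add]; congr 1; ring
    rw [jostSolDeriv, jostSol, h2]
    ring
  refine ⟨hd, ?_⟩
  have hE : IsPrimitive (fun x : ℝ => Complex.exp (-(Complex.I * k * x)))
      (fun x : ℝ => -(Complex.I * k) * Complex.exp (-(Complex.I * k * x))) := by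
    refine isPrimitive_of_hasDerivWithinAt (fun x _ => ?_) (Continuous.continuousOn (by fun_prop))
    simpa [neg_mul] using (hasDerivAt_cexp_mul (-(Complex.I * k)) x).hasDerivWithinAt (s := Ici 0)
  have hET := hE.mul hT
  have hJ : IsPrimitive (jostSol V k) (jostSolDeriv V k) := by
    refine isPrimitive_of_hasDerivWithinAt hd ?_
    have hc : ContinuousOn (jostSol V k) (Ici 0) := fun x hx => (hd x hx).continuousWithinAt
    exact (hc.const_smul (Complex.I * k)).sub hET.continuousOn
  refine ((hJ.const_mul (Complex.I * k)).sub hET).congr_right fun x _ => ?_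
  have h2 : Complex.exp (-(Complex.I * k * x)) * Complex.exp (2 * Complex.I * k * x) =
      Complex.exp (Complex.I * k * x) := by
    rw [← Complex.exp_add]; congr 1; ring
  have h3 : Complex.I * Complex.I = -1 := Complex.I_mul_I
  simp only [jostSolDeriv, jostSol]
  linear_combination (V x * jostFactor V k x) * h2 +
    k ^ 2 * Complex.exp (Complex.I * k * x) * jostFactor V k x * h3

theorem tendsto_jostSol (ha : 0 < a)
    (hV : IntegrableOn (fun x : ℝ => Real.exp (a * x) • V x) (Ioi 0)) (hk : 0 ≤ k.im) :
    Tendsto (fun x : ℝ => jostSol V k x * Complex.exp (-(Complex.I * k * x))) atTop (𝓝 1) := by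
  have hB := kernelBound_mul_exp hV (b := 0) le_rfl (by linarith) (by simpa using hk)
  refine hB.tendsto_jostFactor.congr fun x => ?_
  rw [jostSol, mul_right_comm, ← Complex.exp_add, add_neg_cancel, Complex.exp_zero, one_mul]

theorem norm_jostSol_le (ha : 0 < a)
    (hV : IntegrableOn (fun x : ℝ => Real.exp (a * x) • V x) (Ioi 0)) :
    ∃ C, 0 ≤ C ∧ ∀ k : ℂ, 0 ≤ k.im → ∀ x, 0 ≤ x →
      ‖jostSol V k x‖ ≤ C * Real.exp (-(k.im * x)) := by
  refine ⟨Real.exp (tail (fun t => t * Real.exp (2 * 0 * t) * ‖V t‖) 0), (Real.exp_pos _).le,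
    fun k hk x hx => ?_⟩
  have hB := kernelBound_mul_exp hV (b := 0) le_rfl (by linarith) (by simpa using hk)
  rw [jostSol, norm_mul, Complex.norm_exp, mul_comm]
  refine mul_le_mul (hB.norm_jostFactor_le_const hx) (le_of_eq ?_) (Real.exp_pos _).le
    (Real.exp_pos _).le
  congr 1
  simp

theorem SolvesWith.hasDerivAt {V f y p : ℝ → ℂ} (h : SolvesWith V f y p) {x : ℝ} (hx : 0 < x) :
    HasDerivAt y (p x) x :=
  (h.hasDeriv x hx.le).hasDerivAt (Ici_mem_nhds hx)

/-- A solution that is small at arbitrarily large pairs of points is a multiple of the Jost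
solution. -/
theorem exists_eq_const_mul_jostSol (ha : 0 < a)
    (hV : IntegrableOn (fun x : ℝ => Real.exp (a * x) • V x) (Ioi 0)) (hk : 0 ≤ k.im)
    {u r : ℝ → ℂ} (hu : SolvesWith V (fun x => k ^ 2 * u x) u r)
    (hsmall : ∀ h > 0, ∀ ε > 0, ∃ᶠ x in atTop, ‖u x‖ < ε ∧ ‖u (x + h)‖ < ε) :
    ∃ c, ∀ x, 0 ≤ x → u x = c * jostSol V k x := by
  have hJ := jostSol_solvesWith ha hV hk
  -- Both functions solve the equation with the same k², so their Wronskian is constant and equals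
  -- its limit, zero.
  have hW : ∀ x, 0 ≤ x → jostSol V k x * r x - jostSolDeriv V k x * u x =
      jostSol V k 0 * r 0 - jostSolDeriv V k 0 * u 0 := by
    intro x hx
    have h1 := (hJ.wronskian hu).2 x hx
    have h2 : ∫ t in (0 : ℝ)..x, (k ^ 2 * jostSol V k t * u t - jostSol V k t * (k ^ 2 * u t)) =
        0 := by
      have : ∀ t : ℝ, k ^ 2 * jostSol V k t * u t - jostSol V k t * (k ^ 2 * u t) = 0 :=
        fun t => by ring
      simp [this]
    rw [h2, add_zero] at h1
    exact h1
  have hL := wronskian_limit_eq_zero hk (fun x hx => hJ.hasDerivAt hx) (tendsto_jostSol ha hV hk)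
    (fun x hx => hu.hasDerivAt hx)
    (tendsto_const_nhds.congr' ((eventually_ge_atTop 0).mono fun x hx => (hW x hx).symm)) hsmall
  exact exists_eq_const_mul_of_wronskian (intervalIntegrable_potential ha hV) hJ
    (tendsto_jostSol ha hV hk) hu fun x hx => (hW x hx).trans hL

/-- The difference of two Jost solutions is o(e^{ikx}), hence tends to zero, hence is a multiple c
e. The asymptotics of e then give c = 0. This makes the value chosen by `Classical.epsilon`
irrelevant. -/
theorem IsJostSolution.eq_jostSol (ha : 0 < a)
    (hV : IntegrableOn (fun x : ℝ => Real.exp (a * x) • V x) (Ioi 0)) (hk : 0 ≤ k.im)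
    {y : ℝ → ℂ} (hy : IsJostSolution V k y) {x : ℝ} (hx : 0 ≤ x) : y x = jostSol V k x := by
  obtain ⟨r, hr⟩ := solves_iff.1 hy.1
  have hJ := jostSol_solvesWith ha hV hk
  have hJt := tendsto_jostSol ha hV hk
  have hd := (hr.sub hJ).congr (g := fun x => k ^ 2 * (y x - jostSol V k x)) fun t _ => by ring
  have hlim : Tendsto (fun x : ℝ => (y x - jostSol V k x) * Complex.exp (-(Complex.I * k * x)))
      atTop (𝓝 0) := by
    have := hy.2.sub hJt
    rw [sub_self] at this
    exact this.congr fun x => by ring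
  have hd0 : Tendsto (fun x => y x - jostSol V k x) atTop (𝓝 0) := by
    rw [tendsto_zero_iff_norm_tendsto_zero] at hlim ⊢
    refine squeeze_zero' (Eventually.of_forall fun _ => norm_nonneg _) ?_ hlim
    filter_upwards [eventually_ge_atTop 0] with x hx
    rw [norm_mul]
    refine le_mul_of_one_le_right (norm_nonneg _) ?_
    rw [Complex.norm_exp]
    refine Real.one_le_exp ?_
    simpa using mul_nonneg hk hx
  obtain ⟨c, hc⟩ := exists_eq_const_mul_jostSol ha hV hk hd fun h _ ε hε => by
    have h1 := (tendsto_zero_iff_norm_tendsto_zero.1 hd0).eventually (gt_mem_nhds hε)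
    exact (h1.and ((tendsto_atTop_add_const_right _ h tendsto_id).eventually h1)).frequently
  have hc0 : c = 0 := by
    refine tendsto_nhds_unique ?_ hlim
    have h1 := hJt.const_mul c
    rw [mul_one] at h1
    refine h1.congr' ?_
    filter_upwards [eventually_ge_atTop 0] with x hx
    rw [hc x hx, ← mul_assoc c]
  have := hc x hx
  rw [hc0, zero_mul] at this
  exact sub_eq_zero.1 this

/-- On the closed upper half-plane the Jost function is `m(0, k)`. -/
theorem jost_eq (ha : 0 < a)
    (hV : IntegrableOn (fun x : ℝ => Real.exp (a * x) • V x) (Ioi 0)) (hk : 0 ≤ k.im) :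
    jost V k = jostFactor V k 0 := by
  have hex : ∃ y, IsJostSolution V k y :=
    ⟨jostSol V k, solves_iff.2 ⟨_, jostSol_solvesWith ha hV hk⟩, tendsto_jostSol ha hV hk⟩
  have h := (Classical.epsilon_spec hex).eq_jostSol ha hV hk le_rfl
  rw [jost, jostSolution, h]
  simp [jostSol]

end JostSol

/-! ### The graph of the operator and the kernels of powers -/

theorem SolvesWith.congr_ae {V f g y p : ℝ → ℂ} (h : SolvesWith V f y p)
    (hfg : f =ᵐ[volume.restrict (Ioi (0 : ℝ))] g) : SolvesWith V g y p := by
  have key : ∀ x, 0 ≤ x → (fun t => V t * y t - f t) =ᵐ[volume.restrict (uIoc 0 x)]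
      (fun t => V t * y t - g t) := by
    intro x hx
    have : f =ᵐ[volume.restrict (uIoc 0 x)] g :=
      ae_restrict_of_ae_restrict_of_subset
        (by rw [uIoc_of_le hx]; exact fun t ht => ht.1) hfg
    filter_upwards [this] with t ht
    rw [ht]
  refine ⟨h.hasDeriv, fun x hx => (h.primitive.1 x hx).congr_ae (key x hx), fun x hx => ?_⟩
  rw [h.primitive.2 x hx, intervalIntegral.integral_congr_ae_restrict (key x hx)]

theorem mem_graph_iff {V : ℝ → ℂ} {u f : H} : (u, f) ∈ graph V ↔
    ∃ y r : ℝ → ℂ, u =ᵐ[volume.restrict (Ioi (0 : ℝ))] y ∧ y 0 = 0 ∧ SolvesWith V f y r := by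
  constructor
  · rintro ⟨y, h1, h2, h3⟩
    obtain ⟨r, hr⟩ := solves_iff.1 h3
    exact ⟨y, r, h1, h2, hr⟩
  · rintro ⟨y, r, h1, h2, h3⟩
    exact ⟨y, h1, h2, solves_iff.2 ⟨r, h3⟩⟩

theorem mem_kerPow_succ {V : ℝ → ℂ} {z : ℂ} {n : ℕ} {u : H} :
    u ∈ kerPow (operator V) z (n + 1) ↔
      ∃ f : H, (u, f) ∈ graph V ∧ f - z • u ∈ kerPow (operator V) z n := by
  rw [kerPow, Submodule.mem_map]
  constructor
  · rintro ⟨v, hv, rfl⟩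
    refine ⟨(operator V) v, ?_, hv⟩
    rw [← operator_graph]
    exact LinearPMap.mem_graph _ _
  · rintro ⟨f, hf, hv⟩
    rw [← operator_graph, LinearPMap.mem_graph_iff] at hf
    obtain ⟨y, rfl, rfl⟩ := hf
    exact ⟨y, hv, rfl⟩

theorem rank_ker_le_one {A B : Type*} [AddCommGroup A] [Module ℂ A] [AddCommGroup B] [Module ℂ B]
    (g : A →ₗ[ℂ] B) (h : ∀ u v, g u = 0 → g v = 0 → u ≠ 0 → ∃ c : ℂ, c • u = v) :
    Module.rank ℂ (LinearMap.ker g) ≤ 1 := by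
  refine (rank_le_one_iff (K := ℂ) (V := LinearMap.ker g)).2 ?_
  by_cases hall : ∀ w : LinearMap.ker g, w = 0
  · exact ⟨0, fun v => ⟨0, by rw [hall v, smul_zero]⟩⟩
  · push Not at hall
    obtain ⟨w, hw⟩ := hall
    refine ⟨w, fun v => ?_⟩
    obtain ⟨c, hc⟩ := h w v w.2 v.2 fun h0 => hw (Subtype.ext h0)
    exact ⟨c, Subtype.ext hc⟩

/-- If the eigenspace is at most one-dimensional, then `ker (T - z)ⁿ` has dimension at most `n`. -/
theorem rank_kerPow_le_of_eigen {E : Type*} [AddCommGroup E] [Module ℂ E] (T : E →ₗ.[ℂ] E) (z : ℂ)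
    (h : ∀ u v : T.domain, T u = z • (u : E) → T v = z • (v : E) → (u : E) ≠ 0 →
      ∃ c : ℂ, c • (u : E) = v) (n : ℕ) : Module.rank ℂ (kerPow T z n) ≤ n := by
  induction n with
  | zero =>
    rw [kerPow, Nat.cast_zero]
    exact (rank_bot ℂ E).le
  | succ n ih =>
    rw [kerPow]
    refine (rank_map_le _ _).trans ?_
    -- Rank-nullity for T - z, mapping the kernel of height n + 1 into that of height n; its own
    -- kernel is the eigenspace, of dimension at most 1.
    let g : (kerPow T z n).comap (T.toFun - z • T.domain.subtype) →ₗ[ℂ] kerPow T z n :=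
      (T.toFun - z • T.domain.subtype).restrict fun x hx => hx
    rw [← LinearMap.rank_range_add_rank_ker g, Nat.cast_add, Nat.cast_one]
    refine add_le_add ((Submodule.rank_le _).trans ih) ?_
    have heig : ∀ w, g w = 0 → T w.1 = z • (w.1 : E) := fun w hw =>
      sub_eq_zero.1 (congrArg Subtype.val hw)
    refine rank_ker_le_one g fun u v hu hv hu0 => ?_
    obtain ⟨c, hc⟩ := h u.1 v.1 (heig u hu) (heig v hv)
      fun h0 => hu0 (Subtype.ext (Subtype.ext h0))
    exact ⟨c, Subtype.ext (Subtype.ext hc)⟩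

theorem eq_zero_of_ae_eq {u : H} {y : ℝ → ℂ} (h : u =ᵐ[volume.restrict (Ioi (0 : ℝ))] y)
    (hy : ∀ x, 0 ≤ x → y x = 0) : u = 0 := by
  refine Lp.ext (h.trans (EventuallyEq.trans ?_ (Lp.coeFn_zero _ _ _).symm))
  filter_upwards [ae_restrict_mem measurableSet_Ioi] with x hx
  simpa using hy x (le_of_lt hx)

/-- A square integrable function is small at arbitrarily large pairs of points. -/
theorem frequently_norm_lt_of_memLp {u : ℝ → ℂ} (hu : MemLp u 2 (volume.restrict (Ioi 0)))
    (h : ℝ) {ε : ℝ} (hε : 0 < ε) :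
    ∃ᶠ x in atTop, ‖u x‖ < ε ∧ ‖u (x + h)‖ < ε := by
  intro hev
  obtain ⟨X, hX⟩ := eventually_atTop.1 hev
  set S : Set ℝ := {x | ε ≤ ‖u x‖} ∩ Ioi 0 with hS
  have hSfin : volume S < ⊤ := by
    have := hu.meas_ge_lt_top two_ne_zero ENNReal.ofNat_ne_top (ε := ⟨ε, hε.le⟩)
      (fun h0 => hε.ne' (congrArg NNReal.toReal h0))
    rw [Measure.restrict_apply' measurableSet_Ioi] at this
    exact this
  -- Otherwise a half-line would be covered by the set S where u is large and a translate of it,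
  -- both of finite measure.
  have hsub : Ioi (max X (|h|)) ⊆ S ∪ (fun x => x + h) ⁻¹' S := by
    intro x hx
    have hx1 : X < x := (le_max_left _ _).trans_lt hx
    have hx2 : |h| < x := (le_max_right _ _).trans_lt hx
    have hx3 := neg_abs_le h
    have hx4 := abs_nonneg h
    by_cases hux : ‖u x‖ < ε
    · refine Or.inr ⟨?_, mem_Ioi.2 (by linarith)⟩
      by_contra hcon
      exact hX x hx1.le ⟨hux, not_le.1 hcon⟩
    · exact Or.inl ⟨not_lt.1 hux, mem_Ioi.2 (by linarith)⟩
  have hlt : volume (Ioi (max X (|h|))) < ⊤ := by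
    refine (measure_mono hsub).trans_lt ((measure_union_le _ _).trans_lt ?_)
    rw [measure_preimage_add_right]
    exact ENNReal.add_lt_top.2 ⟨hSfin, hSfin⟩
  rw [Real.volume_Ioi] at hlt
  exact lt_irrefl _ hlt

/-! ### Eigenvalues, root vectors and zeros of the Jost function -/

section Root

variable {V : ℝ → ℂ} {a : ℝ}

theorem solvesWith_of_eigen {z : ℂ} {u : H} (h : (u, z • u) ∈ graph V) :
    ∃ y r : ℝ → ℂ, u =ᵐ[volume.restrict (Ioi (0 : ℝ))] y ∧ y 0 = 0 ∧
      SolvesWith V (fun x => z * y x) y r := by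
  obtain ⟨y, r, h1, h2, h3⟩ := mem_graph_iff.1 h
  refine ⟨y, r, h1, h2, h3.congr_ae ?_⟩
  filter_upwards [Lp.coeFn_smul z u, h1] with x hx hx'
  rw [hx, Pi.smul_apply, smul_eq_mul, hx']

/-- Eigenspaces are at most one-dimensional. -/
theorem exists_smul_eq_of_eigen (ha : 0 < a)
    (hV : IntegrableOn (fun x : ℝ => Real.exp (a * x) • V x) (Ioi 0)) {z : ℂ} {u v : H}
    (hu : (u, z • u) ∈ graph V) (hv : (v, z • v) ∈ graph V) (hu0 : u ≠ 0) : ∃ c : ℂ, c • u = v := by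
  obtain ⟨y, r, h1, h2, h3⟩ := solvesWith_of_eigen hu
  obtain ⟨y', r', h1', h2', h3'⟩ := solvesWith_of_eigen hv
  have hVi := intervalIntegrable_potential ha hV
  have hr0 : r 0 ≠ 0 := fun h0 => hu0 (eq_zero_of_ae_eq h1 (h3.eq_zero_of_initial hVi h2 h0))
  refine ⟨r' 0 / r 0, ?_⟩
  have hd := ((h3.const_mul (r' 0 / r 0)).sub h3').congr
    (g := fun x => z * (r' 0 / r 0 * y x - y' x)) fun t _ => by ring
  have hz := hd.eq_zero_of_initial hVi (by simp [h2, h2']) (by field_simp; ring)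
  refine sub_eq_zero.1 (eq_zero_of_ae_eq (y := fun x => r' 0 / r 0 * y x - y' x) ?_ hz)
  filter_upwards [Lp.coeFn_sub ((r' 0 / r 0) • u) v, Lp.coeFn_smul (r' 0 / r 0) u, h1, h1']
    with x e1 e2 e3 e4
  rw [e1, Pi.sub_apply, e2, Pi.smul_apply, smul_eq_mul, e3, e4]

/-- There are no eigenvalues on `[0, ∞)`. -/
theorem eq_zero_of_eigen_of_real (ha : 0 < a)
    (hV : IntegrableOn (fun x : ℝ => Real.exp (a * x) • V x) (Ioi 0)) {k : ℂ} (hk : k.im = 0)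
    {u : H} (hu : (u, k ^ 2 • u) ∈ graph V) : u = 0 := by
  obtain ⟨y, r, h1, h2, h3⟩ := solvesWith_of_eigen hu
  have hy : MemLp y 2 (volume.restrict (Ioi 0)) := (memLp_congr_ae h1).1 (Lp.memLp u)
  obtain ⟨c, hc⟩ := exists_eq_const_mul_jostSol ha hV hk.ge h3
    fun h _ ε hε => frequently_norm_lt_of_memLp hy h hε
  -- For real k a nonzero multiple of e keeps modulus above ‖c‖/2 far out, which a square integrable
  -- function does not.
  have hc0 : c = 0 := by
    by_contra hc0
    have hJ := ((tendsto_jostSol ha hV hk.ge).const_mul c).norm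
    rw [mul_one] at hJ
    have hpos : 0 < ‖c‖ := norm_pos_iff.2 hc0
    have h4 := hJ.eventually (lt_mem_nhds (half_lt_self hpos))
    obtain ⟨x, ⟨hx1, -⟩, hx2, hx3⟩ := 
      ((frequently_norm_lt_of_memLp hy 0 (half_pos hpos)).and_eventually
        (h4.and (eventually_ge_atTop 0))).exists
    rw [hc x hx3] at hx1
    have h5 : ‖Complex.exp (-(Complex.I * k * x))‖ = 1 := by
      rw [Complex.norm_exp]
      simp [hk]
    rw [← mul_assoc, norm_mul, h5, mul_one] at hx2
    exact lt_asymm hx1 hx2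
  exact eq_zero_of_ae_eq h1 fun x hx => by rw [hc x hx, hc0, zero_mul]

/-- The bilinear pairing of an element of `L²(0, ∞)` with the Jost solution. -/
def jostPairing (V : ℝ → ℂ) (u : H) (κ : ℂ) : ℂ := ∫ x in Ioi (0 : ℝ), jostSol V κ x * u x

theorem memLp_exp_neg {δ : ℝ} (hδ : 0 < δ) :
    MemLp (fun x : ℝ => Real.exp (-(δ * x))) 2 (volume.restrict (Ioi 0)) := by
  rw [memLp_two_iff_integrable_sq (Continuous.aestronglyMeasurable (by fun_prop))]
  refine (exp_neg_integrableOn_Ioi 0 (by linarith : 0 < 2 * δ)).congr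
    (Eventually.of_forall fun x => ?_)
  simp only [← Real.exp_nat_mul]
  congr 1
  push_cast
  ring

theorem integrableOn_jostSol_mul (ha : 0 < a)
    (hV : IntegrableOn (fun x : ℝ => Real.exp (a * x) • V x) (Ioi 0)) {κ : ℂ} (hκ : 0 < κ.im)
    (u : H) : IntegrableOn (fun x => jostSol V κ x * u x) (Ioi 0) := by
  obtain ⟨C, hC0, hC⟩ := norm_jostSol_le ha hV
  have hJ : MemLp (jostSol V κ) 2 (volume.restrict (Ioi 0)) := by
    refine ((memLp_exp_neg hκ).const_mul C).mono' ?_ ?_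
    · exact ((jostSol_solvesWith ha hV hκ.le).continuousOn.mono
        Ioi_subset_Ici_self).aestronglyMeasurable measurableSet_Ioi
    · filter_upwards [ae_restrict_mem measurableSet_Ioi] with x hx
      exact hC κ hκ.le x (le_of_lt hx)
  exact hJ.integrable_mul (Lp.memLp u)

/-- A bound near a point of the open upper half-plane is all that is needed of the pairing: it
cannot compensate for a zero of (κ² - z)^{n+1}. -/
theorem exists_norm_jostPairing_le (ha : 0 < a)
    (hV : IntegrableOn (fun x : ℝ => Real.exp (a * x) • V x) (Ioi 0)) {δ : ℝ} (hδ : 0 < δ)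
    (u : H) : ∃ M, ∀ κ : ℂ, δ ≤ κ.im → ‖jostPairing V u κ‖ ≤ M := by
  obtain ⟨C, hC0, hC⟩ := norm_jostSol_le ha hV
  refine ⟨∫ x in Ioi (0 : ℝ), C * (Real.exp (-(δ * x)) * ‖u x‖), fun κ hκ => ?_⟩
  refine norm_integral_le_of_norm_le
    (((memLp_exp_neg hδ).integrable_mul (Lp.memLp u).norm).const_mul C) ?_
  filter_upwards [ae_restrict_mem measurableSet_Ioi] with x hx
  rw [norm_mul, ← mul_assoc]
  refine mul_le_mul_of_nonneg_right
    ((hC κ (hδ.le.trans hκ) x (le_of_lt hx)).trans ?_) (norm_nonneg _)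
  refine mul_le_mul_of_nonneg_left (Real.exp_le_exp.2 ?_) hC0
  have : δ * x ≤ κ.im * x := mul_le_mul_of_nonneg_right hκ (le_of_lt hx)
  linarith

/-- Green's identity for the pairing with the Jost solution. -/
theorem jostPairing_identity (ha : 0 < a)
    (hV : IntegrableOn (fun x : ℝ => Real.exp (a * x) • V x) (Ioi 0)) {κ : ℂ} (hκ : 0 < κ.im)
    (z : ℂ) {u f : H} {y r : ℝ → ℂ} (hy : u =ᵐ[volume.restrict (Ioi (0 : ℝ))] y) (hy0 : y 0 = 0)
    (hs : SolvesWith V f y r) :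
    (κ ^ 2 - z) * jostPairing V u κ =
      jostPairing V (f - z • u) κ - jostFactor V κ 0 * r 0 := by
  have hJ := jostSol_solvesWith ha hV hκ.le
  have hIu := integrableOn_jostSol_mul ha hV hκ u
  have hIf := integrableOn_jostSol_mul ha hV hκ f
  have hprim := hJ.wronskian hs
  set g : ℝ → ℂ := fun x => κ ^ 2 * jostSol V κ x * y x - jostSol V κ x * f x with hg
  have hae : (fun x => κ ^ 2 * (jostSol V κ x * u x) - jostSol V κ x * f x)
      =ᵐ[volume.restrict (Ioi (0 : ℝ))] g := by
    filter_upwards [hy] with x hx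
    rw [hx, hg]
    ring
  have hgi : IntegrableOn g (Ioi 0) := ((hIu.const_mul (κ ^ 2)).sub hIf).congr hae
  have hgint : ∫ x in Ioi (0 : ℝ), g x = κ ^ 2 * jostPairing V u κ - jostPairing V f κ := by
    rw [← integral_congr_ae hae, integral_sub (hIu.const_mul (κ ^ 2)) hIf, integral_const_mul]
    rfl
  have hlim := (intervalIntegral_tendsto_integral_Ioi 0 hgi tendsto_id).const_add
    (jostSol V κ 0 * r 0 - jostSolDeriv V κ 0 * y 0)
  have hW := hlim.congr' ((eventually_ge_atTop 0).mono fun x hx => (hprim.2 x hx).symm)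
  have hmem : MemLp y 2 (volume.restrict (Ioi 0)) := (memLp_congr_ae hy).1 (Lp.memLp u)
  -- The boundary term at infinity vanishes since u is square integrable; the limit exists because
  -- the Wronskian has an integrable derivative.
  have hL := wronskian_limit_eq_zero hκ.le (fun x hx => hJ.hasDerivAt hx)
    (tendsto_jostSol ha hV hκ.le) (fun x hx => hs.hasDerivAt hx) hW
    fun h _ ε hε => frequently_norm_lt_of_memLp hmem h hε
  have hsub : jostPairing V (f - z • u) κ = jostPairing V f κ - z * jostPairing V u κ := by
    unfold jostPairing
    rw [← integral_const_mul, ← integral_sub hIf (hIu.const_mul z)]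
    refine integral_congr_ae ?_
    filter_upwards [Lp.coeFn_sub f (z • u), Lp.coeFn_smul z u] with x e1 e2
    rw [e1, Pi.sub_apply, e2, Pi.smul_apply, smul_eq_mul]
    ring
  have hJ0 : jostSol V κ 0 = jostFactor V κ 0 := by simp [jostSol]
  rw [hgint, hy0, hJ0] at hL
  rw [hsub]
  linear_combination hL

theorem jostPairing_zero (κ : ℂ) : jostPairing V 0 κ = 0 := by
  unfold jostPairing
  rw [← integral_zero ℝ ℂ (μ := volume.restrict (Ioi (0 : ℝ)))]
  refine integral_congr_ae ?_
  filter_upwards [Lp.coeFn_zero ℂ 2 (volume.restrict (Ioi (0 : ℝ)))] with x hx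
  rw [hx]
  simp

/-- Each use of Green's identity lowers the height by one and adds a boundary term r(0)(κ² - z)^j.
The constant term of P is the derivative at 0 of (T - z)ⁿ u, which solves the eigenvalue equation
and vanishes at 0. If that derivative vanishes too, then (T - z)ⁿ u = 0. -/
theorem exists_polynomial_of_mem_kerPow (ha : 0 < a)
    (hV : IntegrableOn (fun x : ℝ => Real.exp (a * x) • V x) (Ioi 0)) (z : ℂ) (n : ℕ) :
    ∀ u ∈ kerPow (operator V) z (n + 1), ∃ P : Polynomial ℂ,
      (∀ κ : ℂ, 0 < κ.im → (κ ^ 2 - z) ^ (n + 1) * jostPairing V u κ =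
        -(jostFactor V κ 0 * P.eval (κ ^ 2 - z))) ∧
      (P.eval 0 = 0 → u ∈ kerPow (operator V) z n) := by
  induction n with
  | zero =>
    intro u hu
    obtain ⟨f, hf, hv⟩ := mem_kerPow_succ.1 hu
    have hv0 : f - z • u = 0 := by simpa [kerPow] using hv
    obtain ⟨y, r, h1, h2, h3⟩ := mem_graph_iff.1 hf
    refine ⟨Polynomial.C (r 0), fun κ hκ => ?_, fun h0 => ?_⟩
    · have := jostPairing_identity ha hV hκ z h1 h2 h3
      rw [hv0, jostPairing_zero] at this
      rw [zero_add, pow_one, this, Polynomial.eval_C, zero_sub]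
    · rw [sub_eq_zero.1 hv0] at hf
      have hr0 : r 0 = 0 := by simpa using h0
      have h4 : SolvesWith V (fun x => z * y x) y r := by
        refine h3.congr_ae ?_
        rw [sub_eq_zero.1 hv0]
        filter_upwards [Lp.coeFn_smul z u, h1] with x hx hx'
        rw [hx, Pi.smul_apply, smul_eq_mul, hx']
      have := eq_zero_of_ae_eq h1
        (h4.eq_zero_of_initial (intervalIntegrable_potential ha hV) h2 hr0)
      rw [this]
      exact Submodule.zero_mem _
  | succ n ih =>
    intro u hu
    obtain ⟨f, hf, hv⟩ := mem_kerPow_succ.1 hu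
    obtain ⟨P, hP1, hP2⟩ := ih _ hv
    obtain ⟨y, r, h1, h2, h3⟩ := mem_graph_iff.1 hf
    refine ⟨P + Polynomial.C (r 0) * Polynomial.X ^ (n + 1), fun κ hκ => ?_, fun h0 => ?_⟩
    · have e1 := jostPairing_identity ha hV hκ z h1 h2 h3
      have e2 := hP1 κ hκ
      simp only [Polynomial.eval_add, Polynomial.eval_mul, Polynomial.eval_C, Polynomial.eval_pow,
        Polynomial.eval_X]
      linear_combination (κ ^ 2 - z) ^ (n + 1) * e1 + e2
    · refine mem_kerPow_succ.2 ⟨f, hf, hP2 ?_⟩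
      simpa using h0

theorem kerPow_mono_succ (z : ℂ) (n : ℕ) :
    kerPow (operator V) z n ≤ kerPow (operator V) z (n + 1) := by
  induction n with
  | zero => exact bot_le
  | succ n ih =>
    intro u hu
    obtain ⟨f, hf, hv⟩ := mem_kerPow_succ.1 hu
    exact mem_kerPow_succ.2 ⟨f, hf, ih hv⟩

/-- A root vector of height `n + 1` forces the Jost function to vanish to order `n + 1`. -/
theorem isBigO_jostFactor_of_mem_kerPow (ha : 0 < a)
    (hV : IntegrableOn (fun x : ℝ => Real.exp (a * x) • V x) (Ioi 0)) {k : ℂ} (hk : 0 < k.im)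
    {n : ℕ} {u : H} (hu : u ∈ kerPow (operator V) (k ^ 2) (n + 1))
    (hu' : u ∉ kerPow (operator V) (k ^ 2) n) :
    (fun κ => jostFactor V κ 0) =O[𝓝 k] fun κ => (κ - k) ^ (n + 1) := by
  obtain ⟨P, hP1, hP2⟩ := exists_polynomial_of_mem_kerPow ha hV (k ^ 2) n u hu
  have hP0 : P.eval 0 ≠ 0 := fun h => hu' (hP2 h)
  obtain ⟨M, hM⟩ := exists_norm_jostPairing_le ha hV (half_pos hk) u
  have hcont : Tendsto (fun κ : ℂ => P.eval (κ ^ 2 - k ^ 2)) (𝓝 k) (𝓝 (P.eval 0)) := by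
    have : Continuous fun κ : ℂ => P.eval (κ ^ 2 - k ^ 2) :=
      P.continuous.comp (by fun_prop)
    simpa using this.tendsto k
  have hinv : (fun κ : ℂ => (P.eval (κ ^ 2 - k ^ 2))⁻¹) =O[𝓝 k] fun _ => (1 : ℂ) :=
    (hcont.inv₀ hP0).isBigO_one ℂ
  have hpair : (fun κ : ℂ => jostPairing V u κ) =O[𝓝 k] fun _ => (1 : ℂ) := by
    refine Asymptotics.IsBigO.of_bound M ?_
    filter_upwards [Complex.continuous_im.continuousAt.eventually (lt_mem_nhds (half_lt_self hk))]
      with κ hκ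
    simpa using hM κ hκ.le
  have hadd : (fun κ : ℂ => (κ + k) ^ (n + 1)) =O[𝓝 k] fun _ => (1 : ℂ) :=
    ((by fun_prop : Continuous fun κ : ℂ => (κ + k) ^ (n + 1)).tendsto k).isBigO_one ℂ
  -- The identity is solved for the Jost factor: it equals -(κ - k)^{n+1} (κ + k)^{n+1} times the
  -- pairing over P, and all factors but the first are bounded near k.
  have hprod := (((Asymptotics.isBigO_refl (fun κ : ℂ => (κ - k) ^ (n + 1)) (𝓝 k)).mul hadd).mul
    hpair).mul hinv
  simp only [mul_one] at hprod
  refine (hprod.neg_left).congr' ?_ EventuallyEq.rfl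
  filter_upwards [Complex.continuous_im.continuousAt.eventually (lt_mem_nhds hk),
    hcont.eventually_ne hP0] with κ hκ hPκ
  have := hP1 κ hκ
  rw [← mul_pow, show (κ - k) * (κ + k) = κ ^ 2 - k ^ 2 by ring, this]
  field_simp

/-- A bound `O((w - k)ⁿ)` on the closed upper half-plane forces order of vanishing at least `n`. -/
theorem le_analyticOrderAt_of_isBigO {F : ℂ → ℂ} {k : ℂ} (hk : 0 ≤ k.im) (hF : AnalyticAt ℂ F k)
    {n : ℕ} (h : F =O[𝓝[closedUpper] k] fun w => (w - k) ^ n) : (n : ℕ∞) ≤ analyticOrderAt F k := by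
  by_contra hlt
  rw [not_le] at hlt
  obtain ⟨m, hm⟩ := ENat.ne_top_iff_exists.1 hlt.ne_top
  rw [← hm, Nat.cast_lt] at hlt
  obtain ⟨g, hg, hg0, hFg⟩ := hF.analyticOrderAt_eq_natCast.1 hm.symm
  -- The point k is approached along the vertical ray, which stays in the closed upper half-plane.
  -- If the order m were below n, the cofactor g in F = (w - k)^m g would be O(t^{n-m}) there and
  -- vanish at k.
  have hpath0 : Tendsto (fun t : ℝ => k + Complex.I * t) (𝓝[>] 0) (𝓝 k) := by
    have : Continuous fun t : ℝ => k + Complex.I * t := by fun_prop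
    have h1 := this.tendsto 0
    simp only [Complex.ofReal_zero, mul_zero, add_zero] at h1
    exact h1.mono_left nhdsWithin_le_nhds
  have hpath : Tendsto (fun t : ℝ => k + Complex.I * t) (𝓝[>] 0) (𝓝[closedUpper] k) := by
    refine tendsto_nhdsWithin_iff.2 ⟨hpath0, ?_⟩
    filter_upwards [self_mem_nhdsWithin] with t ht
    have ht0 : (0 : ℝ) < t := ht
    simp only [closedUpper, mem_ofPred_eq, Complex.add_im, Complex.mul_im, Complex.I_re,
      Complex.I_im, Complex.ofReal_re, Complex.ofReal_im]
    linarith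
  obtain ⟨C, hC⟩ := (h.comp_tendsto hpath).bound
  have hbound : ∀ᶠ t : ℝ in 𝓝[>] 0, ‖g (k + Complex.I * t)‖ ≤ C * t ^ (n - m) := by
    filter_upwards [hC, hpath0.eventually hFg, self_mem_nhdsWithin] with t h1 h2 ht
    have ht0 : (0 : ℝ) < t := ht
    simp only [Function.comp_apply] at h1
    rw [h2, add_sub_cancel_left, norm_smul, norm_pow, norm_pow, norm_mul, Complex.norm_I, one_mul,
      Complex.norm_real, Real.norm_of_nonneg ht0.le] at h1
    have h3 : t ^ n = t ^ m * t ^ (n - m) := by rw [← pow_add]; congr 1; omega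
    rw [h3, mul_left_comm] at h1
    exact le_of_mul_le_mul_left h1 (pow_pos ht0 m)
  have hz : Tendsto (fun t : ℝ => C * t ^ (n - m)) (𝓝[>] 0) (𝓝 0) := by
    have : Continuous fun t : ℝ => C * t ^ (n - m) := by fun_prop
    have h1 := this.tendsto 0
    simp only [zero_pow (by omega : n - m ≠ 0), mul_zero] at h1
    exact h1.mono_left nhdsWithin_le_nhds
  have hgt := hg.continuousAt.tendsto.comp hpath0
  have hg00 : Tendsto (g ∘ fun t : ℝ => k + Complex.I * t) (𝓝[>] 0) (𝓝 0) :=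
    squeeze_zero_norm' hbound hz
  exact hg0 (tendsto_nhds_unique hgt hg00)

theorem rank_kerPow_le (ha : 0 < a)
    (hV : IntegrableOn (fun x : ℝ => Real.exp (a * x) • V x) (Ioi 0)) (z : ℂ) (n : ℕ) :
    Module.rank ℂ (kerPow (operator V) z n) ≤ n := by
  have hgraph : ∀ w : (operator V).domain, operator V w = z • (w : H) →
      ((w : H), z • (w : H)) ∈ graph V := by
    intro w hw
    rw [← operator_graph, ← hw]
    exact LinearPMap.mem_graph _ _
  exact rank_kerPow_le_of_eigen (operator V) z (fun u v hu hv hu0 =>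
    exists_smul_eq_of_eigen ha hV (hgraph u hu) (hgraph v hv) hu0) n

/-- Each such k lies in a half-plane Im k > -b with 0 < b < a/2, on which one integrable q serves
all spectral parameters. This is the continuation of the Jost function across the real axis. -/
theorem analyticOnNhd_jostFactor (ha : 0 < a)
    (hV : IntegrableOn (fun x : ℝ => Real.exp (a * x) • V x) (Ioi 0)) :
    AnalyticOnNhd ℂ (fun κ => jostFactor V κ 0) {k | -(a / 2) < k.im} := by
  intro k hk
  have hk' : -(a / 2) < k.im := hk
  obtain ⟨b, hb1, hb2⟩ := exists_between (max_lt (by linarith : -k.im < a / 2) (half_pos ha))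
  have hb0 : 0 < b := (le_max_right _ _).trans_lt hb1
  have hkb : -k.im < b := (le_max_left _ _).trans_lt hb1
  have hopen : IsOpen {k : ℂ | -b < k.im} := isOpen_lt continuous_const Complex.continuous_im
  exact (differentiableOn_jostFactor hopen
    (fun κ hκ => kernelBound_mul_exp hV hb0.le (by linarith) (le_of_lt hκ)) le_rfl).analyticAt
    (hopen.mem_nhds (show -b < k.im by linarith))

/-- The algebraic multiplicity of an eigenvalue is at most the order of the zero of the Jost
function. -/
theorem algMultiplicity_le (ha : 0 < a)
    (hV : IntegrableOn (fun x : ℝ => Real.exp (a * x) • V x) (Ioi 0)) {k : ℂ} (hk : 0 < k.im) :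
    algMultiplicity (operator V) (k ^ 2) ≤ analyticOrderAt (fun κ => jostFactor V κ 0) k := by
  rcases eq_or_ne (analyticOrderAt (fun κ => jostFactor V κ 0) k) ⊤ with htop | htop
  · rw [htop]; exact le_top
  obtain ⟨N, hN⟩ := ENat.ne_top_iff_exists.1 htop
  have hF := analyticOnNhd_jostFactor ha hV k (show -(a / 2) < k.im by linarith)
  -- A root vector of exact height n + 1 > N would force a zero of order above N, so the chain of
  -- kernels is stationary from N on, and the kernel of height N has dimension at most N.
  have hstep : ∀ n, N ≤ n → kerPow (operator V) (k ^ 2) (n + 1) ≤ kerPow (operator V) (k ^ 2) n := by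
    intro n hn u hu
    by_contra hu'
    have := le_analyticOrderAt_of_isBigO hk.le hF
      ((isBigO_jostFactor_of_mem_kerPow ha hV hk hu hu').mono nhdsWithin_le_nhds)
    rw [← hN, Nat.cast_le] at this
    omega
  have hsup : (⨆ n, kerPow (operator V) (k ^ 2) n) ≤ kerPow (operator V) (k ^ 2) N := by
    refine iSup_le fun n => ?_
    rcases le_total n N with h | h
    · exact monotone_nat_of_le_succ (kerPow_mono_succ (k ^ 2)) h
    · induction n, h using Nat.le_induction with
      | base => exact le_rfl
      | succ n hn ih => exact (hstep n hn).trans ih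
  rw [algMultiplicity, ← hN, ← Cardinal.toENat_nat]
  exact OrderHomClass.mono Cardinal.toENat
    ((Submodule.rank_mono hsup).trans (rank_kerPow_le ha hV _ N))

theorem algMultiplicity_eq_zero (ha : 0 < a)
    (hV : IntegrableOn (fun x : ℝ => Real.exp (a * x) • V x) (Ioi 0)) {k : ℂ} (hk : k.im = 0) :
    algMultiplicity (operator V) (k ^ 2) = 0 := by
  have hbot : ∀ n, kerPow (operator V) (k ^ 2) n = ⊥ := by
    intro n
    induction n with
    | zero => rfl
    | succ n ih =>
      rw [eq_bot_iff]
      intro u hu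
      obtain ⟨f, hf, hv⟩ := mem_kerPow_succ.1 hu
      rw [ih, Submodule.mem_bot, sub_eq_zero] at hv
      rw [hv] at hf
      exact (Submodule.mem_bot ℂ).2 (eq_zero_of_eigen_of_real ha hV hk hf)
  simp [algMultiplicity, hbot]

theorem boundaryOrder_jost_le (ha : 0 < a)
    (hV : IntegrableOn (fun x : ℝ => Real.exp (a * x) • V x) (Ioi 0)) (k : ℝ) :
    boundaryOrder (jost V) k ≤ analyticOrderAt (fun κ => jostFactor V κ 0) (k : ℂ) := by
  refine iSup₂_le fun n hn => ?_
  refine le_analyticOrderAt_of_isBigO (by simp)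
    (analyticOnNhd_jostFactor ha hV _ (by simpa using ha)) (hn.congr' ?_ EventuallyEq.rfl)
  filter_upwards [self_mem_nhdsWithin] with w hw
  exact jost_eq ha hV hw

end Root

/-! ### Jensen's inequality and the counting of zeros -/

/-- Jensen's inequality for the number of zeros of `f` in a set contained in `closedBall c r`. -/
theorem tsum_analyticOrderAt_le {f : ℂ → ℂ} {c : ℂ} {r ρ M : ℝ} (hr : 0 < r) (hrρ : r < ρ)
    (hM : 1 ≤ M) (hf : AnalyticOnNhd ℂ f (Metric.closedBall c ρ)) (hc : f c ≠ 0)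
    (hb : ∀ z ∈ Metric.sphere c ρ, ‖f z‖ ≤ M) {o : ℂ → ℕ∞} (ho : ∀ z, o z ≤ analyticOrderAt f z)
    (hoz : ∀ z, z ∉ Metric.closedBall c r → o z = 0) :
    ∑' z, (o z : ℝ≥0∞) ≤ ENNReal.ofReal (Real.log (M / ‖f c‖) / Real.log (ρ / r)) := by
  have hρ : 0 < ρ := hr.trans hrρ
  have hJ := AnalyticOnNhd.sum_divisor_le (c := c) (r := r) (R := ρ) (M := M) (f := f)
    (by rwa [abs_of_pos hr]) (by rwa [abs_of_pos hr, abs_of_pos hρ]) hM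
    (by rwa [abs_of_pos hρ]) hc (by rwa [abs_of_pos hρ])
  rw [abs_of_pos hr] at hJ
  have hfr : AnalyticOnNhd ℂ f (Metric.closedBall c r) :=
    hf.mono (Metric.closedBall_subset_closedBall hrρ.le)
  set D := MeromorphicOn.divisor f (Metric.closedBall c r) with hD
  have hD0 : ∀ z, 0 ≤ D z := fun z => MeromorphicOn.AnalyticOnNhd.divisor_nonneg hfr z
  have hfin : (Function.support D).Finite := D.finiteSupport (isCompact_closedBall c r)
  have hle : ∀ z, (o z : ℝ≥0∞) ≤ ENNReal.ofReal (D z) := by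
    intro z
    by_cases hz : z ∈ Metric.closedBall c r
    -- Since f c ≠ 0 and the disc is connected, f vanishes identically near no point of it; the
    -- order then is the value of the divisor.
    · have hne : analyticOrderAt f z ≠ ⊤ := by
        refine hfr.analyticOrderAt_ne_top_of_isPreconnected
          (convex_closedBall c r).isPreconnected (Metric.mem_closedBall_self hr.le) hz ?_
        rw [(hfr c (Metric.mem_closedBall_self hr.le)).analyticOrderAt_eq_zero.2 hc]
        exact ENat.zero_ne_top
      have hval : D z = (analyticOrderAt f z).toNat := by
        obtain ⟨n, hn⟩ := ENat.ne_top_iff_exists.1 hne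
        rw [hD, MeromorphicOn.AnalyticOnNhd.divisor_apply hfr hz, ← hn]
        rfl
      rw [hval]
      have h1 : ((analyticOrderAt f z).toNat : ℕ∞) = analyticOrderAt f z := ENat.natCast_toNat hne
      have h2 := ENat.toENNReal_le.2 (ho z)
      rw [← h1] at h2
      simpa using h2
    · simp [hoz z hz]
  rw [ENNReal.tsum_eq_iSup_sum]
  refine iSup_le fun S => ?_
  refine (Finset.sum_le_sum fun z _ => hle z).trans ?_
  rw [← ENNReal.ofReal_sum_of_nonneg fun z _ => by exact_mod_cast hD0 z]
  refine ENNReal.ofReal_le_ofReal (le_trans ?_ hJ)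
  rw [finsum_eq_sum_of_support_subset (s := S ∪ hfin.toFinset) _ (by
    intro z hz
    simpa using Or.inr hz)]
  push_cast
  exact Finset.sum_le_sum_of_subset_of_nonneg Finset.subset_union_left
    fun z _ _ => by exact_mod_cast hD0 z

/-- The square root with nonnegative imaginary part. -/
theorem exists_sq_eq_im_nonneg (z : ℂ) : ∃ k : ℂ, k ^ 2 = z ∧ 0 ≤ k.im := by
  obtain ⟨k, hk⟩ := IsAlgClosed.exists_pow_nat_eq z two_pos
  rcases le_total 0 k.im with h | h
  · exact ⟨k, hk, h⟩
  · exact ⟨-k, by rw [neg_sq, hk], by simpa using h⟩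

section Count

variable {V : ℝ → ℂ} {a : ℝ}

/-- The order of the zeros of the Jost function in the closed upper half-plane. -/
def jostOrder (V : ℝ → ℂ) (k : ℂ) : ℕ∞ :=
  if 0 ≤ k.im then analyticOrderAt (fun κ => jostFactor V κ 0) k else 0

/-- The square root with Im ≥ 0 is injective, and eigenvalues go to zeros in the open half-plane
because real k contribute none. Spectral singularities occupy the real zeros, so no zero is used
twice. -/
theorem totalMultiplicity_le_tsum (ha : 0 < a)
    (hV : IntegrableOn (fun x : ℝ => Real.exp (a * x) • V x) (Ioi 0)) :
    totalMultiplicity V ≤ ∑' k, (jostOrder V k : ℝ≥0∞) := by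
  classical
  choose κ hκ hκ0 using exists_sq_eq_im_nonneg
  have hinj : Function.Injective κ := fun z w h => by rw [← hκ z, ← hκ w, h]
  let G : ℂ → ℝ≥0∞ := fun k => if 0 < k.im then jostOrder V k else 0
  let B : ℂ → ℝ≥0∞ := fun k => if k.im = 0 then jostOrder V k else 0
  have h1 : ∑' z : ℂ, (algMultiplicity (operator V) z : ℝ≥0∞) ≤ ∑' k, G k := by
    refine (ENNReal.tsum_le_tsum fun z => ?_).trans
      (ENNReal.tsum_comp_le_tsum_of_injective hinj G)
    rcases (hκ0 z).lt_or_eq with h | h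
    · simp only [G, if_pos h, jostOrder, if_pos h.le]
      have := algMultiplicity_le ha hV h
      rw [hκ z] at this
      exact ENat.toENNReal_le.2 this
    · have := algMultiplicity_eq_zero ha hV h.symm
      rw [hκ z] at this
      simp [this]
  have h2 : ∑' k : ℝ, (boundaryOrder (jost V) k : ℝ≥0∞) ≤ ∑' k, B k := by
    refine (ENNReal.tsum_le_tsum fun k => ?_).trans
      (ENNReal.tsum_comp_le_tsum_of_injective Complex.ofReal_injective B)
    simp only [B, Complex.ofReal_im, if_true, jostOrder, le_refl]
    exact ENat.toENNReal_le.2 (boundaryOrder_jost_le ha hV k)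
  refine (add_le_add h1 h2).trans ?_
  rw [← ENNReal.tsum_add]
  refine ENNReal.tsum_le_tsum fun k => ?_
  rcases lt_trichotomy k.im 0 with h | h | h
  · simp [G, B, h.not_gt, h.ne]
  · simp [G, B, h]
  · simp [G, B, h, h.ne']

/-- At a zero k ≠ 0, |m - 1| ≤ e^Q - 1 with Q(0) = ∫|V| / |k| gives Q(0) ≥ ln 2. The infimum that
defines `zeroRadius` is thus over a nonempty set. -/
theorem exists_norm_le_of_jost_eq_zero (ha : 0 < a)
    (hV : IntegrableOn (fun x : ℝ => Real.exp (a * x) • V x) (Ioi 0)) :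
    ∃ r : ℝ, 0 ≤ r ∧ ∀ k ∈ closedUpper, jost V k = 0 → ‖k‖ ≤ r := by
  have hlog : 0 < Real.log 2 := Real.log_pos (by norm_num)
  have hI : 0 ≤ ∫ t in Ioi (0 : ℝ), ‖V t‖ := integral_nonneg fun _ => norm_nonneg _
  refine ⟨(∫ t in Ioi (0 : ℝ), ‖V t‖) / Real.log 2, by positivity, fun k hk h0 => ?_⟩
  by_contra hcon
  rw [not_le, div_lt_iff₀ hlog] at hcon
  have hk0 : 0 < ‖k‖ := by
    by_contra h
    have : ‖k‖ = 0 := le_antisymm (not_lt.1 h) (norm_nonneg _)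
    rw [this, zero_mul] at hcon
    linarith
  have hkim : 0 ≤ k.im := hk
  have hB := kernelBound_rpow hV (b := 0) (β := 0) le_rfl (by linarith) (by simpa using hkim) hk0
    le_rfl ⟨le_rfl, one_pos⟩
  have h1 := hB.norm_jostFactor_sub_one_le le_rfl
  rw [jost_eq ha hV hkim] at h0
  have h2 : tail (fun t : ℝ => 1 / (2 * ‖k‖) ^ (1 - (0 : ℝ)) *
      (t ^ (0 : ℝ) * (1 + Real.exp (2 * 0 * t)) * ‖V t‖)) 0 =
      (∫ t in Ioi (0 : ℝ), ‖V t‖) / ‖k‖ := by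
    rw [tail, ← integral_div]
    refine integral_congr_ae (Eventually.of_forall fun t => ?_)
    simp only [sub_zero, Real.rpow_one, Real.rpow_zero, mul_zero, zero_mul, Real.exp_zero]
    field_simp
    norm_num
  rw [h2, h0, zero_sub, norm_neg, norm_one] at h1
  have h3 : (∫ t in Ioi (0 : ℝ), ‖V t‖) / ‖k‖ < Real.log 2 := by
    rw [div_lt_iff₀ hk0]; linarith
  have h4 := Real.exp_lt_exp.2 h3
  rw [Real.exp_log two_pos] at h4
  linarith

theorem norm_le_zeroRadius (ha : 0 < a)
    (hV : IntegrableOn (fun x : ℝ => Real.exp (a * x) • V x) (Ioi 0)) {k : ℂ} (hk : 0 ≤ k.im)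
    (h0 : jost V k = 0) : ‖k‖ ≤ zeroRadius V :=
  le_csInf (exists_norm_le_of_jost_eq_zero ha hV) fun _ hr => hr.2 k hk h0

theorem radiusBound_nonneg (α : ℝ) : 0 ≤ radiusBound V α := by
  refine Real.rpow_nonneg (mul_nonneg ?_ ?_) _
  · exact one_div_nonneg.2 (Real.log_nonneg (by norm_num))
  · exact setIntegral_nonneg measurableSet_Ioi fun x hx =>
      mul_nonneg (Real.rpow_nonneg (by linarith [mem_Ioi.1 hx]) _) (norm_nonneg _)

/-- The lower bound for the Jost function at `iA`. -/
theorem le_norm_jostFactor_I_mul (ha : 0 < a)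
    (hV : IntegrableOn (fun x : ℝ => Real.exp (a * x) • V x) (Ioi 0)) {α A : ℝ}
    (hα : α ∈ Ico (0 : ℝ) 1) (hA : 0 < A) :
    2 - (2 : ℝ) ^ ((radiusBound V α / A) ^ (1 - α)) ≤ ‖jostFactor V (Complex.I * A) 0‖ := by
  have hlog : 0 < Real.log 2 := Real.log_pos (by norm_num)
  have h1α : 0 < 1 - α := by linarith [hα.2]
  have hn : ‖Complex.I * (A : ℂ)‖ = A := by simp [abs_of_pos hA]
  have hB := kernelBound_rpow hV (b := 0) (k := Complex.I * A) le_rfl (by linarith)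
    (by simpa using hA.le) hA hn.ge hα
  have h1 := hB.norm_jostFactor_sub_one_le le_rfl
  set J := ∫ x in Ioi (0 : ℝ), (2 * x) ^ α * ‖V x‖ with hJ
  have hJ0 : 0 ≤ J := setIntegral_nonneg measurableSet_Ioi fun x hx =>
    mul_nonneg (Real.rpow_nonneg (by linarith [mem_Ioi.1 hx]) _) (norm_nonneg _)
  -- With b = 0 the factor 1 + e^{2bt} is 2, and 2 t^α/(2A)^{1-α} = (2t)^α/A^{1-α}; hence the weight
  -- (2x)^α in `radiusBound`.
  have h2 : tail (fun t : ℝ => 1 / (2 * A) ^ (1 - α) *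
      (t ^ α * (1 + Real.exp (2 * 0 * t)) * ‖V t‖)) 0 = J / A ^ (1 - α) := by
    rw [tail, hJ, ← integral_div]
    refine setIntegral_congr_fun measurableSet_Ioi fun t ht => ?_
    have ht0 : (0 : ℝ) < t := ht
    have hA' : (0 : ℝ) < A ^ (1 - α) := Real.rpow_pos_of_pos hA _
    have h2' : (0 : ℝ) < 2 ^ (1 - α) := Real.rpow_pos_of_pos two_pos _
    have h22 : (2 : ℝ) ^ α * 2 ^ (1 - α) = 2 := by
      rw [← Real.rpow_add two_pos]; simp
    simp only [mul_zero, zero_mul, Real.exp_zero]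
    rw [Real.mul_rpow two_pos.le hA.le, Real.mul_rpow two_pos.le ht0.le]
    field_simp
    linear_combination -‖V t‖ * h22
  have h3 : (radiusBound V α / A) ^ (1 - α) = J / A ^ (1 - α) / Real.log 2 := by
    rw [Real.div_rpow (radiusBound_nonneg α) hA.le, radiusBound, ← Real.rpow_mul (by positivity),
      one_div_mul_cancel h1α.ne', Real.rpow_one]
    ring
  have h4 : (2 : ℝ) ^ ((radiusBound V α / A) ^ (1 - α)) = Real.exp (J / A ^ (1 - α)) := by
    rw [h3, Real.rpow_def_of_pos two_pos, mul_div_cancel₀ _ hlog.ne']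
  rw [h2] at h1
  rw [h4]
  have h5 : (1 : ℝ) ≤ ‖jostFactor V (Complex.I * A) 0‖ +
      ‖jostFactor V (Complex.I * A) 0 - 1‖ := by
    have := norm_sub_le (jostFactor V (Complex.I * A) 0) (jostFactor V (Complex.I * A) 0 - 1)
    simpa using this
  linarith

/-- Positivity excludes a zero at iA and makes the logarithm meaningful; the bound by 1 makes its
negative a nonnegative term. -/
theorem two_sub_rpow_mem {α A : ℝ} (hα : α ∈ Ico (0 : ℝ) 1) (hA : radiusBound V α < A) :
    2 - (2 : ℝ) ^ ((radiusBound V α / A) ^ (1 - α)) ∈ Ioc (0 : ℝ) 1 := by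
  have h0 := radiusBound_nonneg (V := V) α
  have hA0 : 0 < A := h0.trans_lt hA
  have h1 : (radiusBound V α / A) ^ (1 - α) < 1 :=
    Real.rpow_lt_one (by positivity) ((div_lt_one hA0).2 hA) (by linarith [hα.2])
  have h2 : 0 ≤ (radiusBound V α / A) ^ (1 - α) := by positivity
  have h3 : (2 : ℝ) ^ ((radiusBound V α / A) ^ (1 - α)) < 2 := by
    simpa using Real.rpow_lt_rpow_of_exponent_lt (by norm_num : (1 : ℝ) < 2) h1
  have h4 := Real.one_le_rpow (by norm_num : (1 : ℝ) ≤ 2) h2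
  exact ⟨by linarith, by linarith⟩

/-- The upper bound for the Jost function on the circle about `iA` of radius `A + b`. -/
theorem norm_jostFactor_le_of_mem_sphere
    (hV : IntegrableOn (fun x : ℝ => Real.exp (a * x) • V x) (Ioi 0)) {β A b : ℝ}
    (hβ : β ∈ Ico (0 : ℝ) 1) (hA : 0 < A) (hb : 0 < b) (hba : 2 * b < a) {k : ℂ}
    (hk : k ∈ Metric.sphere (Complex.I * A) (A + b)) :
    ‖jostFactor V k 0‖ ≤ Real.exp (1 / (2 * b) ^ (1 - β) *
      ∫ t in Ioi (0 : ℝ), t ^ β * (1 + Real.exp (2 * b * t)) * ‖V t‖) := by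
  rw [mem_sphere_iff_norm] at hk
  have him : -b ≤ k.im := by
    have h1 := (Complex.abs_im_le_norm (k - Complex.I * A)).trans_eq hk
    have h2 : (k - Complex.I * A).im = k.im - A := by simp
    rw [h2] at h1
    linarith [neg_abs_le (k.im - A)]
  -- The origin is at distance A from the centre, so the circle of radius A + b stays at distance at
  -- least b from it. Hence c = b in the interpolated kernel bound.
  have hnorm : b ≤ ‖k‖ := by
    have h1 := norm_sub_le k (Complex.I * A)
    have hn : ‖Complex.I * (A : ℂ)‖ = A := by simp [abs_of_pos hA]
    rw [hk, hn] at h1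
    linarith
  have h := (kernelBound_rpow hV hb.le hba him hb hnorm hβ).norm_jostFactor_le le_rfl
  rwa [tail, integral_const_mul] at h

/-- Jensen's inequality centred at iA. The restriction 2b < a keeps the closed disc of radius A + b
inside the half-plane of analyticity, whose boundary the disc of radius A + a/2 would touch. -/
theorem totalMultiplicity_le_of_lt (ha : 0 < a)
    (hV : IntegrableOn (fun x : ℝ => Real.exp (a * x) • V x) (Ioi 0)) {α β A b : ℝ}
    (hα : α ∈ Ico (0 : ℝ) 1) (hβ : β ∈ Ico (0 : ℝ) 1) (hA : radiusBound V α < A) (hb : 0 < b)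
    (hba : 2 * b < a) (hAb : √(A ^ 2 + zeroRadius V ^ 2) < A + b) :
    totalMultiplicity V ≤ ENNReal.ofReal ((1 / (2 * b) ^ (1 - β) *
        (∫ t in Ioi (0 : ℝ), t ^ β * (1 + Real.exp (2 * b * t)) * ‖V t‖) -
        Real.log (2 - (2 : ℝ) ^ ((radiusBound V α / A) ^ (1 - α)))) /
      Real.log ((A + b) / √(A ^ 2 + zeroRadius V ^ 2))) := by
  have hA0 : 0 < A := (radiusBound_nonneg α).trans_lt hA
  have hr : 0 < √(A ^ 2 + zeroRadius V ^ 2) := Real.sqrt_pos.2 (by positivity)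
  have hlow := two_sub_rpow_mem hα hA
  have hFA := le_norm_jostFactor_I_mul ha hV hα hA0
  have hFpos := hlow.1.trans_le hFA
  have hI : 0 ≤ 1 / (2 * b) ^ (1 - β) *
      ∫ t in Ioi (0 : ℝ), t ^ β * (1 + Real.exp (2 * b * t)) * ‖V t‖ := by
    refine mul_nonneg (by positivity) (setIntegral_nonneg measurableSet_Ioi fun t ht => ?_)
    have : (0 : ℝ) < t := ht
    positivity
  have hsub : Metric.closedBall (Complex.I * A) (A + b) ⊆ {k : ℂ | -(a / 2) < k.im} := by
    intro k hk
    rw [Metric.mem_closedBall, dist_eq_norm] at hk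
    have h1 := (Complex.abs_im_le_norm (k - Complex.I * A)).trans hk
    have h2 : (k - Complex.I * A).im = k.im - A := by simp
    rw [h2] at h1
    have h3 := neg_abs_le (k.im - A)
    exact show -(a / 2) < k.im by linarith
  have hJ := tsum_analyticOrderAt_le hr hAb (Real.one_le_exp hI)
    ((analyticOnNhd_jostFactor ha hV).mono hsub) (norm_pos_iff.1 hFpos)
    (fun k hk => norm_jostFactor_le_of_mem_sphere hV hβ hA0 hb hba hk) (o := jostOrder V)
    (fun k => by
      unfold jostOrder
      split_ifs
      · exact le_rfl
      · exact zero_le)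
    (fun k hk => by
      unfold jostOrder
      split_ifs with h
      · refine (analyticOnNhd_jostFactor ha hV k
          (show -(a / 2) < k.im by linarith)).analyticOrderAt_eq_zero.2 fun h0 => hk ?_
        rw [← jost_eq ha hV h] at h0
        have h1 := norm_le_zeroRadius ha hV h h0
        rw [Metric.mem_closedBall, dist_eq_norm]
        refine Real.le_sqrt_of_sq_le ?_
        have h2 : ‖k‖ ^ 2 ≤ zeroRadius V ^ 2 := pow_le_pow_left₀ (norm_nonneg _) h1 2
        rw [Complex.sq_norm, Complex.normSq_apply] at h2 ⊢
        simp only [Complex.sub_re, Complex.sub_im, Complex.mul_re, Complex.mul_im, Complex.I_re,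
          Complex.I_im, Complex.ofReal_re, Complex.ofReal_im]
        -- |k - iA|² = |k|² - 2A Im k + A², and the middle term has the favourable sign.
        nlinarith [mul_nonneg hA0.le h]
      · rfl)
  refine ((totalMultiplicity_le_tsum ha hV).trans hJ).trans (ENNReal.ofReal_le_ofReal ?_)
  have hlogpos : 0 < Real.log ((A + b) / √(A ^ 2 + zeroRadius V ^ 2)) :=
    Real.log_pos ((one_lt_div hr).2 hAb)
  rw [Real.log_div (Real.exp_pos _).ne' hFpos.ne', Real.log_exp]
  gcongr
  exact hlow.1

/-- (A + a/2)² - A² = a(A + a/4), so the second lower bound on A says exactly that the disc of zeros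
is the smaller one. -/
theorem sqrt_lt_of_lt (ha : 0 < a) {A R : ℝ} (hA : 0 < A) (h : R ^ 2 / a - a / 4 < A) :
    √(A ^ 2 + R ^ 2) < A + a / 2 := by
  rw [Real.sqrt_lt' (by positivity)]
  have : R ^ 2 < a * (A + a / 4) := by
    rw [sub_lt_iff_lt_add, div_lt_iff₀ ha] at h
    linarith
  nlinarith

/-- Passage to the limit b ↑ a/2. The exponential e^{2bt} is first enlarged to e^{at}, so only
explicit continuous functions of b remain. -/
theorem totalMultiplicity_le (ha : 0 < a)
    (hV : IntegrableOn (fun x : ℝ => Real.exp (a * x) • V x) (Ioi 0)) {α β A : ℝ}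
    (hα : α ∈ Ico (0 : ℝ) 1) (hβ : β ∈ Ico (0 : ℝ) 1) (hA : radiusBound V α < A)
    (hAa : √(A ^ 2 + zeroRadius V ^ 2) < A + a / 2)
    (hI : IntegrableOn (fun t : ℝ => t ^ β * (1 + Real.exp (a * t)) * ‖V t‖) (Ioi 0)) :
    totalMultiplicity V ≤ ENNReal.ofReal ((1 / a ^ (1 - β) *
        (∫ t in Ioi (0 : ℝ), t ^ β * (1 + Real.exp (a * t)) * ‖V t‖) -
        Real.log (2 - (2 : ℝ) ^ ((radiusBound V α / A) ^ (1 - α)))) /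
      Real.log ((A + a / 2) / √(A ^ 2 + zeroRadius V ^ 2))) := by
  have hA0 : 0 < A := (radiusBound_nonneg α).trans_lt hA
  have hr : 0 < √(A ^ 2 + zeroRadius V ^ 2) := Real.sqrt_pos.2 (by positivity)
  set I := ∫ t in Ioi (0 : ℝ), t ^ β * (1 + Real.exp (a * t)) * ‖V t‖ with hIdef
  set ℓ := Real.log (2 - (2 : ℝ) ^ ((radiusBound V α / A) ^ (1 - α))) with hℓ
  set r := √(A ^ 2 + zeroRadius V ^ 2) with hrdef
  have hlogpos : 0 < Real.log ((A + a / 2) / r) := Real.log_pos ((one_lt_div hr).2 hAa)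
  have hcont : ContinuousAt (fun b : ℝ => (1 / (2 * b) ^ (1 - β) * I - ℓ) /
      Real.log ((A + b) / r)) (a / 2) := by
    have h2 : (2 * (a / 2)) ^ (1 - β) ≠ 0 := (Real.rpow_pos_of_pos (by positivity) _).ne'
    have h3 : ContinuousAt (fun b : ℝ => (2 * b) ^ (1 - β)) (a / 2) :=
      ContinuousAt.rpow_const (by fun_prop) (Or.inl (by positivity))
    refine ContinuousAt.div (((continuousAt_const.div h3 h2).mul continuousAt_const).sub
      continuousAt_const) (ContinuousAt.log (by fun_prop) ?_) hlogpos.ne'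
    positivity
  have hlim := (ENNReal.continuous_ofReal.tendsto _).comp
    (hcont.tendsto.mono_left (nhdsWithin_le_nhds (s := Iio (a / 2))))
  rw [show 2 * (a / 2) = a by ring] at hlim
  refine ge_of_tendsto hlim ?_
  have hev : ∀ᶠ b in 𝓝[<] (a / 2), max 0 (r - A) < b :=
    nhdsWithin_le_nhds (lt_mem_nhds (max_lt (by positivity) (by linarith)))
  filter_upwards [hev, self_mem_nhdsWithin] with b hb hb2
  have hb0 : 0 < b := (le_max_left _ _).trans_lt hb
  have hbA : r < A + b := by linarith [(le_max_right 0 (r - A)).trans_lt hb]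
  have hba : 2 * b < a := by linarith [mem_Iio.1 hb2]
  refine (totalMultiplicity_le_of_lt ha hV hα hβ hA hb0 hba hbA).trans
    (ENNReal.ofReal_le_ofReal ?_)
  have hlogb : 0 < Real.log ((A + b) / r) := Real.log_pos ((one_lt_div hr).2 hbA)
  refine div_le_div_of_nonneg_right (sub_le_sub_right (mul_le_mul_of_nonneg_left ?_
    (by positivity)) _) hlogb.le
  have hle : ∀ t ∈ Ioi (0 : ℝ), t ^ β * (1 + Real.exp (2 * b * t)) * ‖V t‖ ≤
      t ^ β * (1 + Real.exp (a * t)) * ‖V t‖ := by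
    intro t ht
    have ht0 : (0 : ℝ) < t := ht
    gcongr
  refine integral_mono_of_nonneg ?_ hI ?_
  · filter_upwards [ae_restrict_mem measurableSet_Ioi] with t ht
    have ht0 : (0 : ℝ) < t := ht
    simp only [Pi.zero_apply]
    positivity
  · filter_upwards [ae_restrict_mem measurableSet_Ioi] with t ht using hle t ht

end Count

end HalfLineSchrodinger

end

/-- The integral in the bound is taken in `[0, ∞]`, since it may diverge when `β > 0`; the
inequality is one of extended reals. -/
theorem theorem1 (V : ℝ → ℂ) (a : ℝ) (ha : 0 < a)
    (hV : IntegrableOn (fun x : ℝ => Real.exp (a * x) • V x) (Ioi 0))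
    (α β : ℝ) (hα : α ∈ Ico (0 : ℝ) 1) (hβ : β ∈ Ico (0 : ℝ) 1) (A : ℝ)
    (hA : max (HalfLineSchrodinger.radiusBound V α)
      (HalfLineSchrodinger.zeroRadius V ^ 2 / a - a / 4) < A) :
    (HalfLineSchrodinger.totalMultiplicity V : EReal) ≤
      (((Real.log ((A + a / 2) / √(A ^ 2 + HalfLineSchrodinger.zeroRadius V ^ 2)))⁻¹ : ℝ) : EReal) *
        (((1 / a ^ (1 - β) : ℝ) : EReal) *
            ((∫⁻ x in Ioi (0 : ℝ),
              ENNReal.ofReal (x ^ β * (1 + Real.exp (a * x)) * ‖V x‖) : ℝ≥0∞) : EReal) -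
          ((Real.log (2 - (2 : ℝ) ^
            ((HalfLineSchrodinger.radiusBound V α / A) ^ (1 - α))) : ℝ) : EReal)) := by
  have hA1 := (le_max_left _ _).trans_lt hA
  have hA0 : 0 < A := (HalfLineSchrodinger.radiusBound_nonneg α).trans_lt hA1
  have hAa := HalfLineSchrodinger.sqrt_lt_of_lt ha hA0 ((le_max_right _ _).trans_lt hA)
  have hr : 0 < √(A ^ 2 + HalfLineSchrodinger.zeroRadius V ^ 2) := Real.sqrt_pos.2 (by positivity)
  have hlogpos : 0 < Real.log ((A + a / 2) / √(A ^ 2 + HalfLineSchrodinger.zeroRadius V ^ 2)) :=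
    Real.log_pos ((one_lt_div hr).2 hAa)
  have hapos : 0 < 1 / a ^ (1 - β) := one_div_pos.2 (Real.rpow_pos_of_pos ha _)
  set g : ℝ → ℝ := fun x => x ^ β * (1 + Real.exp (a * x)) * ‖V x‖ with hg
  have hg0 : 0 ≤ᵐ[volume.restrict (Ioi (0 : ℝ))] g := by
    filter_upwards [ae_restrict_mem measurableSet_Ioi] with t ht
    have ht0 : (0 : ℝ) < t := ht
    simp only [Pi.zero_apply, hg]
    positivity
  have hgm : AEStronglyMeasurable g (volume.restrict (Ioi (0 : ℝ))) :=
    ((Real.continuous_rpow_const hβ.1).mul (by fun_prop)).aestronglyMeasurable.mul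
      (HalfLineSchrodinger.aestronglyMeasurable_potential hV).norm
  -- If the integral diverges, the positive prefactors make the right-hand side ⊤.
  by_cases hfin : ∫⁻ x in Ioi (0 : ℝ), ENNReal.ofReal (g x) = ⊤
  · rw [hfin, EReal.coe_ennreal_top, EReal.coe_mul_top_of_pos hapos, EReal.top_sub_coe,
      EReal.coe_mul_top_of_pos (inv_pos.2 hlogpos)]
    exact le_top
  · have hgi : IntegrableOn g (Ioi 0) := by
      refine ⟨hgm, ?_⟩
      rw [hasFiniteIntegral_iff_ofReal hg0]
      exact lt_top_iff_ne_top.2 hfin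
    have hI : 0 ≤ ∫ x in Ioi (0 : ℝ), g x := integral_nonneg_of_ae hg0
    have hlow := HalfLineSchrodinger.two_sub_rpow_mem hα hA1
    have hlog : Real.log (2 - (2 : ℝ) ^
        ((HalfLineSchrodinger.radiusBound V α / A) ^ (1 - α))) ≤ 0 :=
      Real.log_nonpos hlow.1.le hlow.2
    have hT := HalfLineSchrodinger.totalMultiplicity_le ha hV hα hβ hA1 hAa hgi
    have hT' := EReal.coe_ennreal_le_coe_ennreal_iff.2 hT
    -- The truncation at 0 in `ENNReal.ofReal` is harmless: the logarithm subtracted is nonpositive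
    -- and the integral nonnegative.
    rw [EReal.coe_ennreal_ofReal, max_eq_left (div_nonneg (sub_nonneg.2
      (hlog.trans (mul_nonneg hapos.le hI))) hlogpos.le)] at hT'
    rw [← ofReal_integral_eq_lintegral_ofReal hgi hg0, EReal.coe_ennreal_ofReal, max_eq_left hI]
    refine hT'.trans (le_of_eq ?_)
    rw [← EReal.coe_mul, ← EReal.coe_sub, ← EReal.coe_mul, div_eq_inv_mul]
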